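/- Let $H^2(\mathbb{D}^2)$ be the Hardy space of holomorphic functions on the bidisk with square-summable Taylor coefficients. For $j=1,2$ let $a_j,c_j>0$ be real, and let $p_j(z)=a_j-z_1+c_jz_2$ have no zeros in $\mathbb{D}^2$ and a zero $\tau_j=(\tau_{1,j},\tau_{2,j})\in\mathbb{T}^2$, so that $$\theta_j=\frac{\tilde p_j}{p_j},\qquad \tilde p_j(z)=z_1z_2\,\overline{p_j(1/\bar z_1,1/\bar z_2)}=a_jz_1z_2-z_2+c_jz_1,$$ is a rational inner function of degree $(1,1)$. Put $\Theta=\theta_1\theta_2$ and $$f_j(z)=\frac{\sqrt{a_jc_j}\,(z_2-\tau_{2,j})}{p_j(z)},\qquad \mathcal{S}_{2,\theta_j}=\mathcal{H}\!\left(\frac{f_j(z)\overline{f_j(w)}}{1-z_2\bar w_2}\right)\subseteq H^2(\mathbb{D}^2),\qquad \mathcal{S}_2=\mathcal{S}_{2,\theta_1}\oplus\theta_1\mathcal{S}_{2,\theta_2},$$ where $\mathcal{H}(K)$ is the closed subspace of $H^2(\mathbb{D}^2)$ with reproducing kernel $K$. Let $S^1_\Theta=P_{\mathcal{S}_2}M_{z_1}|_{\mathcal{S}_2}$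 be the compression to $\mathcal{S}_2$ of multiplication by $z_1$ on $H^2(\mathbb{D}^2)$, and let $\mathcal{W}(S^1_\Theta)=\{\langle S^1_\Theta h,h\rangle : h\in\mathcal{S}_2,\ \|h\|=1\}$ be its numerical range. Then - $0$ lies in the interior of $\mathcal{W}(S^1_\Theta)$ if and only if $c_1c_2>\frac12$; - $0$ lies in the boundary $\partial\mathcal{W}(S^1_\Theta)$ if and only if $c_1c_2=\frac12$. -/

import Mathlib

open scoped ComplexConjugate

noncomputable section

namespace BidiskShift

/-- The open unit bidisk `𝔻²`. -/
def bidisk : Set (ℂ × ℂ) := {z | ‖z.1‖ < 1 ∧ ‖z.2‖ < 1}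

/-! ### The Hardy space of the bidisk -/

/-- The Hardy space `H²(𝔻²)`: holomorphic functions on the bidisk with square-summable Taylor
coefficients. An element is stored as its family of coefficients, `F (m, n)` being the coefficient
of `z₁ ^ m * z₂ ^ n`; the inner product is the `ℓ²` inner product of the coefficients. -/
abbrev Hardy : Type := lp (fun _ : ℕ × ℕ => ℂ) 2

/-- The value at `z` of the holomorphic function on the bidisk represented by `F`. -/
def Hardy.eval (F : Hardy) (z : ℂ × ℂ) : ℂ := ∑' k : ℕ × ℕ, F k * (z.1 ^ k.1 * z.2 ^ k.2)

/-- The power series of an element of `H²(𝔻²)` converges absolutely on the bidisk. -/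
theorem Hardy.summable_eval (F : Hardy) {z : ℂ × ℂ} (hz : z ∈ bidisk) :
    Summable fun k : ℕ × ℕ => F k * (z.1 ^ k.1 * z.2 ^ k.2) := by
  have h1 := summable_geometric_of_lt_one (norm_nonneg z.1) hz.1
  have h2 := summable_geometric_of_lt_one (norm_nonneg z.2) hz.2
  have h3 : Summable fun k : ℕ × ℕ => ‖z.1‖ ^ k.1 * ‖z.2‖ ^ k.2 :=
    h1.mul_of_nonneg h2 (fun _ => by positivity) (fun _ => by positivity)
  refine Summable.of_norm_bounded (h3.mul_left ‖F‖) fun k => ?_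
  rw [norm_mul, norm_mul, norm_pow, norm_pow]
  gcongr
  exact lp.norm_apply_le_norm (by norm_num) F k

theorem Hardy.eval_zero (z : ℂ × ℂ) : Hardy.eval 0 z = 0 := by
  simp [Hardy.eval]

theorem Hardy.eval_add (F G : Hardy) {z : ℂ × ℂ} (hz : z ∈ bidisk) :
    (F + G).eval z = F.eval z + G.eval z := by
  unfold Hardy.eval
  rw [← (F.summable_eval hz).tsum_add (G.summable_eval hz)]
  exact tsum_congr fun k => by rw [lp.coeFn_add, Pi.add_apply, add_mul]

theorem Hardy.eval_smul (c : ℂ) (F : Hardy) (z : ℂ × ℂ) :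
    (c • F).eval z = c * F.eval z := by
  unfold Hardy.eval
  rw [← tsum_mul_left]
  exact tsum_congr fun k => by rw [lp.coeFn_smul, Pi.smul_apply, smul_eq_mul, mul_assoc]

/-! ### Multiplication by the first coordinate -/

/-- The Taylor coefficients of `z₁ F`, in terms of those of `F`. -/
def shiftCoeff (F : ℕ × ℕ → ℂ) (k : ℕ × ℕ) : ℂ := if k.1 = 0 then 0 else F (k.1 - 1, k.2)

theorem injective_succFst : Function.Injective fun k : ℕ × ℕ => (k.1 + 1, k.2) := by
  rintro ⟨a, b⟩ ⟨c, d⟩ h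
  simpa using h

theorem shiftCoeff_succ (F : ℕ × ℕ → ℂ) (k : ℕ × ℕ) :
    shiftCoeff F (k.1 + 1, k.2) = F k := by
  simp [shiftCoeff]

theorem shiftCoeff_of_notMem (F : ℕ × ℕ → ℂ) (k : ℕ × ℕ)
    (hk : k ∉ Set.range fun k : ℕ × ℕ => (k.1 + 1, k.2)) : shiftCoeff F k = 0 := by
  rcases k with ⟨_ | m, n⟩
  · simp [shiftCoeff]
  · exact absurd ⟨(m, n), rfl⟩ hk

theorem hasSum_shiftCoeff {F : Hardy} :
    HasSum (fun k => ‖shiftCoeff F k‖ ^ (2 : ENNReal).toReal) (‖F‖ ^ (2 : ENNReal).toReal) := by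
  rw [← injective_succFst.hasSum_iff]
  · simpa only [Function.comp_def, shiftCoeff_succ] using lp.hasSum_norm (by norm_num) F
  · intro k hk
    simp [shiftCoeff_of_notMem _ k hk]

/-- The operator `M_{z₁}` of multiplication by `z₁` on `H²(𝔻²)`. -/
def mulZ₁ : Hardy →L[ℂ] Hardy :=
  LinearIsometry.toContinuousLinearMap
    { toFun := fun F => ⟨shiftCoeff F, memℓp_gen hasSum_shiftCoeff.summable⟩
      map_add' := fun F G => by
        ext k
        simp only [lp.coeFn_add, Pi.add_apply, shiftCoeff]
        split_ifs <;> simp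
      map_smul' := fun c F => by
        ext k
        simp only [lp.coeFn_smul, Pi.smul_apply, shiftCoeff, RingHom.id_apply, smul_eq_mul]
        split_ifs <;> simp
      norm_map' := fun F => by
        have h1 := lp.hasSum_norm (p := 2) (by norm_num)
          (⟨shiftCoeff F, memℓp_gen hasSum_shiftCoeff.summable⟩ : Hardy)
        have h2 := h1.unique (hasSum_shiftCoeff (F := F))
        exact (Real.rpow_left_inj (norm_nonneg _) (norm_nonneg _) (by norm_num)).1 h2 }

/-- `mulZ₁` is multiplication of functions on the bidisk by the first coordinate. -/
theorem eval_mulZ₁ (F : Hardy) (z : ℂ × ℂ) : (mulZ₁ F).eval z = z.1 * F.eval z := by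
  have h : ∀ k, (mulZ₁ F) k = shiftCoeff F k := fun _ => rfl
  unfold Hardy.eval
  rw [← tsum_mul_left, ← injective_succFst.tsum_eq]
  · refine tsum_congr fun k => ?_
    rw [h, shiftCoeff_succ]
    ring
  · intro k hk
    by_contra hk'
    exact hk (by simp only [h, shiftCoeff_of_notMem _ k hk', zero_mul])

/-! ### Rational inner functions of degree `(1, 1)` -/

/-- The polynomial `p(z) = a + b z₁ + c z₂ + d z₁ z₂`. -/
def poly (a b c d : ℂ) (z : ℂ × ℂ) : ℂ := a + b * z.1 + c * z.2 + d * z.1 * z.2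

/-- The reflection `p̃(z) = z₁ z₂ conj (p (1 / conj z₁, 1 / conj z₂))` of `poly a b c d`. -/
def polyRefl (a b c d : ℂ) (z : ℂ × ℂ) : ℂ :=
  conj a * z.1 * z.2 + conj b * z.2 + conj c * z.1 + conj d

/-- The rational function `θ = p̃ / p`. It is inner when `p` has no zeros on the bidisk. -/
def theta (a b c d : ℂ) (z : ℂ × ℂ) : ℂ := polyRefl a b c d z / poly a b c d z

/-- The function `f(z) = lam (z₂ - τ₂) / p(z)` with `|lam|² = |conj a * c - d * conj b|`,
where `τ₂` is the second coordinate of the zero of `p` on the torus. -/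
def kerFactor (a b c d τ₂ : ℂ) (z : ℂ × ℂ) : ℂ :=
  (Real.sqrt ‖conj a * c - d * conj b‖ : ℂ) * (z.2 - τ₂) / poly a b c d z

/-! ### The subspaces -/

/-- The Hilbert space `ℋ(K)` with reproducing kernel `K(z, w)`, for a kernel whose space is
isometrically contained in `H²(𝔻²)`: the closed linear span in `H²(𝔻²)` of the kernel
functions `K(·, w)`, `w ∈ 𝔻²`. -/
def kernelSpace (K : ℂ × ℂ → ℂ × ℂ → ℂ) : Submodule ℂ Hardy :=
  (Submodule.span ℂ {F : Hardy | ∃ w ∈ bidisk, ∀ z ∈ bidisk, F.eval z = K z w}).topologicalClosure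

/-- The `z₂`-invariant subspace `𝒮_{2,θ} = ℋ (f(z) conj (f(w)) / (1 - z₂ conj w₂))` of the
model space `H²(𝔻²) ⊖ θ H²(𝔻²)`, where `f = kerFactor a b c d τ₂`. -/
def S₂theta (a b c d τ₂ : ℂ) : Submodule ℂ Hardy :=
  kernelSpace fun z w =>
    kerFactor a b c d τ₂ z * conj (kerFactor a b c d τ₂ w) / (1 - z.2 * conj w.2)

/-- The subspace `θ S = {θ G : G ∈ S}` of `H²(𝔻²)`. -/
def mulSpace (θ : ℂ × ℂ → ℂ) (S : Submodule ℂ Hardy) : Submodule ℂ Hardy where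
  carrier := {F | ∃ G ∈ S, ∀ z ∈ bidisk, F.eval z = θ z * G.eval z}
  zero_mem' := ⟨0, S.zero_mem, fun z _ => by simp [Hardy.eval_zero]⟩
  add_mem' := by
    rintro F₁ F₂ ⟨G₁, h₁, e₁⟩ ⟨G₂, h₂, e₂⟩
    refine ⟨G₁ + G₂, S.add_mem h₁ h₂, fun z hz => ?_⟩
    rw [Hardy.eval_add _ _ hz, Hardy.eval_add _ _ hz, e₁ z hz, e₂ z hz, mul_add]
  smul_mem' := by
    rintro c F ⟨G, h, e⟩
    refine ⟨c • G, S.smul_mem c h, fun z hz => ?_⟩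
    rw [Hardy.eval_smul, Hardy.eval_smul, e z hz]
    ring

/-- The subspace `𝒮₂ = 𝒮_{2,θ₁} ⊕ θ₁ 𝒮_{2,θ₂}` of the model space of `Θ = θ₁ θ₂`, where
`θⱼ = p̃ⱼ / pⱼ`, `pⱼ = aⱼ + bⱼ z₁ + cⱼ z₂ + dⱼ z₁ z₂`, and `tⱼ` is the second coordinate of the zero
of `pⱼ` on the torus. The two summands are closed and orthogonal, so that taking the closure adds
nothing; it makes the completeness of `𝒮₂` evident. -/
def S₂prod (a₁ b₁ c₁ d₁ t₁ a₂ b₂ c₂ d₂ t₂ : ℂ) : Submodule ℂ Hardy :=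
  (S₂theta a₁ b₁ c₁ d₁ t₁ ⊔
    mulSpace (theta a₁ b₁ c₁ d₁) (S₂theta a₂ b₂ c₂ d₂ t₂)).topologicalClosure

instance (a₁ b₁ c₁ d₁ t₁ a₂ b₂ c₂ d₂ t₂ : ℂ) :
    CompleteSpace (S₂prod a₁ b₁ c₁ d₁ t₁ a₂ b₂ c₂ d₂ t₂) :=
  (Submodule.isClosed_topologicalClosure _).completeSpace_coe

/-! ### Compressions and numerical ranges -/

/-- The compression `P_S T|_S` of a bounded operator `T` to a subspace `S`. -/
def compression (S : Submodule ℂ Hardy) [S.HasOrthogonalProjection] (T : Hardy →L[ℂ] Hardy) :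
    S →L[ℂ] S :=
  S.orthogonalProjectionOnto ∘L T ∘L S.subtypeL

/-- The compressed shift `S¹_Θ = P_{𝒮₂} M_{z₁}|_{𝒮₂}` for `Θ = θ₁ θ₂`. -/
def compressedShift (a₁ b₁ c₁ d₁ t₁ a₂ b₂ c₂ d₂ t₂ : ℂ) :
    S₂prod a₁ b₁ c₁ d₁ t₁ a₂ b₂ c₂ d₂ t₂ →L[ℂ] S₂prod a₁ b₁ c₁ d₁ t₁ a₂ b₂ c₂ d₂ t₂ :=
  compression (S₂prod a₁ b₁ c₁ d₁ t₁ a₂ b₂ c₂ d₂ t₂) mulZ₁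

/-- The numerical range `{⟨T h, h⟩ : ‖h‖ = 1}`. Mathlib's inner product is linear in its second
argument. -/
def numericalRange {E : Type*} [NormedAddCommGroup E] [InnerProductSpace ℂ E]
    (T : E →L[ℂ] E) : Set ℂ :=
  {x | ∃ h : E, ‖h‖ = 1 ∧ inner ℂ h (T h) = x}

end BidiskShift

end

/-! A zero on the torus together with none in the bidisk forces a_j = 1 + c_j and τ_{2,j} = -1
(`eq_one_add_and_eq_neg_one`). Write D_j = 1 + c_j + c_j z₂. Multiplication by f_j is isometric on
functions of z₂ alone, and on the resulting functions x_j = f_j g_j the adjoint of M_{z₁} is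
division by D_j (`IsKernelPair.norm_eq`, `IsKernelPair.adjoint_apply`).

For h = x₁ + θ₁x₂ the form ⟨z₁h, h⟩ therefore consists of two diagonal terms, with real parts Re⟨x_j
/ D_j, x_j⟩, and one cross term of modulus at most ‖k₁‖‖k₂‖, where k_j is the part of x_j free of z₁
(`IsKernelPair.inner_add_thetaOp`). With X_j = ‖x_j / D_j‖² and q_j = ‖(1 + z₂)x_j / D_j‖² ≤ 4X_j,
the diagonal real parts are X_j + c_j q_j / 2 ≥ (1 + 2c_j)q_j / 4, while ‖k_j‖² = (1 + c_j)c_j q_j.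
By AM-GM the real part is nonnegative when 4(1 + c₁)c₁(1 + c₂)c₂ ≤ (1 + 2c₁)(1 + 2c₂). The left side
minus the right side is (2c₁c₂ - 1)(2c₁c₂ + 2c₁ + 2c₂ + 1), so the condition is c₁c₂ ≤ 1/2, and
strict inequality keeps the numerical range away from 0 (`quadratic_bound`).

The bound is sharp near z₂ = 1. If g₁ and g₂ are multiples of the Szegő kernel at w ∈ [0, 1), the
form becomes that of a triangular 2 × 2 matrix with explicit entries
(`mem_numericalRange_compressedShift`). As w → 1 these matrices put 0 in the interior when c₁c₂ >
1/2 and in the closure when c₁c₂ = 1/2. -/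

open scoped ComplexConjugate

noncomputable section

namespace BidiskShift

open ContinuousLinearMap Filter Topology

/-! ### Operator calculus of p and p̃ for a doubly commuting pair of isometries. -/

section Abstract

variable {H : Type*} [NormedAddCommGroup H] [InnerProductSpace ℂ H]

/-- The operator `(1 + c) + c W`. -/
def den (c : ℝ) (W : H →L[ℂ] H) : H →L[ℂ] H := ((1 + c : ℝ) : ℂ) • 1 + ((c : ℝ) : ℂ) • W

/-- The operator `(1 + c) W + c`. -/
def denRefl (c : ℝ) (W : H →L[ℂ] H) : H →L[ℂ] H := ((1 + c : ℝ) : ℂ) • W + ((c : ℝ) : ℂ) • 1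

/-- The operator `p(Z, W)` for `p(z) = (1 + c) - z₁ + c z₂`. -/
def pOp (c : ℝ) (Z W : H →L[ℂ] H) : H →L[ℂ] H := den c W - Z

/-- The operator `p̃(Z, W)` for `p(z) = (1 + c) - z₁ + c z₂`. -/
def pReflOp (c : ℝ) (Z W : H →L[ℂ] H) : H →L[ℂ] H := Z * denRefl c W - W

/-- The inverse of `(1 + c) + c W`. -/
def denInv (c : ℝ) (W : H →L[ℂ] H) : H →L[ℂ] H := Ring.inverse (den c W)

theorem den_apply (c : ℝ) (W : H →L[ℂ] H) (x : H) :
    den c W x = ((1 + c : ℝ) : ℂ) • x + (c : ℂ) • W x := rfl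

theorem denRefl_apply (c : ℝ) (W : H →L[ℂ] H) (x : H) :
    denRefl c W x = ((1 + c : ℝ) : ℂ) • W x + (c : ℂ) • x := rfl

theorem pOp_apply (c : ℝ) (Z W : H →L[ℂ] H) (x : H) : pOp c Z W x = den c W x - Z x := rfl

theorem pReflOp_apply (c : ℝ) (Z W : H →L[ℂ] H) (x : H) :
    pReflOp c Z W x = Z (denRefl c W x) - W x := rfl

theorem norm_sq_smul_add_smul (α β : ℝ) (x y : H) :
    ‖(α : ℂ) • x + (β : ℂ) • y‖ ^ 2 =
      α ^ 2 * ‖x‖ ^ 2 + β ^ 2 * ‖y‖ ^ 2 + 2 * α * β * (inner ℂ x y).re := by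
  have h := norm_add_sq (𝕜 := ℂ) ((α : ℂ) • x) ((β : ℂ) • y)
  rw [h, norm_smul, norm_smul, inner_smul_left, inner_smul_right]
  simp only [Complex.norm_real, Real.norm_eq_abs, mul_pow, sq_abs, Complex.conj_ofReal,
    RCLike.re_eq_complex_re, Complex.re_ofReal_mul]
  ring

theorem commute_den {T W : H →L[ℂ] H} {c : ℝ} (hT : Commute T W) : Commute T (den c W) :=
  ((Commute.one_right T).smul_right _).add_right (hT.smul_right _)

theorem commute_denRefl {T W : H →L[ℂ] H} {c : ℝ} (hT : Commute T W) : Commute T (denRefl c W) :=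
  (hT.smul_right _).add_right ((Commute.one_right T).smul_right _)

theorem commute_pOp {T Z W : H →L[ℂ] H} {c : ℝ} (hZ : Commute T Z) (hW : Commute T W) :
    Commute T (pOp c Z W) := (commute_den hW).sub_right hZ

theorem commute_pReflOp {T Z W : H →L[ℂ] H} {c : ℝ} (hZ : Commute T Z) (hW : Commute T W) :
    Commute T (pReflOp c Z W) := (hZ.mul_right (commute_denRefl hW)).sub_right hW

variable [CompleteSpace H]

/-- A doubly commuting pair of isometries, such that `-1` is not an eigenvalue of the adjoint of the
second one. -/
structure IsShiftPair (Z W : H →L[ℂ] H) : Prop where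
  fst : adjoint Z * Z = 1
  snd : adjoint W * W = 1
  comm : Commute Z W
  adjoint_comm : Commute (adjoint Z) W
  eq_zero_of_adjoint : ∀ x, adjoint W x = -x → x = 0

theorem inner_map_map_of_adjoint_mul {T : H →L[ℂ] H} (h : adjoint T * T = 1) (x y : H) :
    inner ℂ (T x) (T y) = inner ℂ x y := by
  rw [← adjoint_inner_left, show adjoint T (T x) = x from congr($h x)]

theorem norm_map_of_adjoint_mul {T : H →L[ℂ] H} (h : adjoint T * T = 1) (x : H) :
    ‖T x‖ = ‖x‖ := by
  rw [norm_eq_sqrt_re_inner (𝕜 := ℂ), inner_map_map_of_adjoint_mul h,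
    ← norm_eq_sqrt_re_inner (𝕜 := ℂ)]

theorem norm_adjoint_apply_le {T : H →L[ℂ] H} (h : adjoint T * T = 1) (x : H) :
    ‖adjoint T x‖ ≤ ‖x‖ := by
  have h1 : ‖adjoint T‖ ≤ 1 := by
    rw [LinearIsometryEquiv.norm_map]
    exact opNorm_le_bound _ zero_le_one fun y => by rw [norm_map_of_adjoint_mul h, one_mul]
  simpa using (adjoint T).le_of_opNorm_le h1 x

namespace IsShiftPair

variable {Z W : H →L[ℂ] H} {c : ℝ}

theorem norm_fst (h : IsShiftPair Z W) (x : H) : ‖Z x‖ = ‖x‖ := norm_map_of_adjoint_mul h.fst x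

theorem norm_snd (h : IsShiftPair Z W) (x : H) : ‖W x‖ = ‖x‖ := norm_map_of_adjoint_mul h.snd x

theorem inner_fst (h : IsShiftPair Z W) (x y : H) : inner ℂ (Z x) (Z y) = inner ℂ x y :=
  inner_map_map_of_adjoint_mul h.fst x y

theorem inner_snd (h : IsShiftPair Z W) (x y : H) : inner ℂ (W x) (W y) = inner ℂ x y :=
  inner_map_map_of_adjoint_mul h.snd x y

theorem comm_apply (h : IsShiftPair Z W) (x : H) : Z (W x) = W (Z x) := congr($h.comm.eq x)

theorem adjoint_comm_apply (h : IsShiftPair Z W) (x : H) :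
    adjoint Z (W x) = W (adjoint Z x) := congr($h.adjoint_comm.eq x)

theorem adjoint_fst_apply (h : IsShiftPair Z W) (x : H) : adjoint Z (Z x) = x := congr($h.fst x)

theorem adjoint_snd_apply (h : IsShiftPair Z W) (x : H) : adjoint W (W x) = x := congr($h.snd x)

/-- Neumann series: W is a contraction and c / (1 + c) < 1. -/
theorem isUnit_den (h : IsShiftPair Z W) (hc : 0 < c) : IsUnit (den c W) := by
  have h1 : ‖-((c / (1 + c) : ℝ) : ℂ) • W‖ < 1 := by
    have h2 : ‖W‖ ≤ 1 := opNorm_le_bound _ zero_le_one fun y => by rw [h.norm_snd, one_mul]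
    rw [norm_smul, norm_neg, Complex.norm_real, Real.norm_eq_abs, abs_of_pos (by positivity)]
    calc c / (1 + c) * ‖W‖ ≤ c / (1 + c) * 1 := by gcongr
      _ < 1 := by rw [mul_one, div_lt_one (by positivity)]; linarith
  have h3 := isUnit_one_sub_of_norm_lt_one h1
  have h4 : ((1 + c : ℝ) : ℂ) ≠ 0 := by exact_mod_cast (by positivity : (1 + c : ℝ) ≠ 0)
  have h5 : den c W = (Units.mk0 _ h4) • (1 - -((c / (1 + c) : ℝ) : ℂ) • W) := by
    ext x
    simp only [den, Units.smul_mk0, add_apply, FunLike.coe_smul, Pi.smul_apply, sub_apply,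
      smul_sub, smul_smul]
    rw [mul_neg, neg_smul, sub_neg_eq_add]
    congr 2
    push_cast at h4 ⊢
    field_simp
  rw [h5]
  exact h3.smul _

theorem den_denInv (h : IsShiftPair Z W) (hc : 0 < c) (x : H) : den c W (denInv c W x) = x :=
  congr($(Ring.mul_inverse_cancel _ (h.isUnit_den hc)) x)

theorem denInv_den (h : IsShiftPair Z W) (hc : 0 < c) (x : H) : denInv c W (den c W x) = x :=
  congr($(Ring.inverse_mul_cancel _ (h.isUnit_den hc)) x)

theorem commute_denInv (h : IsShiftPair Z W) (hc : 0 < c) {T : H →L[ℂ] H} (hT : Commute T W) :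
    Commute T (denInv c W) := by
  have h1 := Ring.mul_inverse_cancel _ (h.isUnit_den hc)
  have h2 := Ring.inverse_mul_cancel _ (h.isUnit_den hc)
  have h3 : T * den c W = den c W * T := commute_den hT
  change T * Ring.inverse (den c W) = Ring.inverse (den c W) * T
  calc T * Ring.inverse (den c W)
      = Ring.inverse (den c W) * den c W * T * Ring.inverse (den c W) := by rw [h2, one_mul]
    _ = Ring.inverse (den c W) * (T * den c W) * Ring.inverse (den c W) := by
        rw [h3, mul_assoc (Ring.inverse _)]
    _ = Ring.inverse (den c W) * T := by rw [mul_assoc, mul_assoc, h1, mul_one]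

/-! ### Norm identities -/

theorem norm_add_snd_sq (h : IsShiftPair Z W) (x : H) :
    ‖x + W x‖ ^ 2 = 2 * ‖x‖ ^ 2 + 2 * (inner ℂ x (W x)).re := by
  have := norm_sq_smul_add_smul 1 1 x (W x)
  simp only [Complex.ofReal_one, one_smul, h.norm_snd] at this
  rw [this]; ring

/-- Operator form of |1 + c + cζ|² = 1 + (1 + c)c|1 + ζ|² for |ζ| = 1. All later norm computations
rest on it. -/
theorem norm_den_sq (h : IsShiftPair Z W) (x : H) :
    ‖den c W x‖ ^ 2 = ‖x‖ ^ 2 + (1 + c) * c * ‖x + W x‖ ^ 2 := by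
  rw [den_apply, norm_sq_smul_add_smul, h.norm_add_snd_sq, h.norm_snd]
  ring

theorem norm_denRefl (h : IsShiftPair Z W) (x : H) : ‖denRefl c W x‖ = ‖den c W x‖ := by
  rw [← sq_eq_sq₀ (norm_nonneg _) (norm_nonneg _), den_apply, denRefl_apply,
    norm_sq_smul_add_smul, norm_sq_smul_add_smul, h.norm_snd, ← inner_conj_symm (W x) x,
    Complex.conj_re]

/-- Operator form of |p̃| = |p| on the torus; it makes multiplication by θ isometric. -/
theorem norm_pReflOp (h : IsShiftPair Z W) (x : H) : ‖pReflOp c Z W x‖ = ‖pOp c Z W x‖ := by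
  rw [← sq_eq_sq₀ (norm_nonneg _) (norm_nonneg _), pOp_apply, pReflOp_apply,
    norm_sub_sq (𝕜 := ℂ), norm_sub_sq (𝕜 := ℂ), h.norm_fst, h.norm_fst, h.norm_snd,
    h.norm_denRefl]
  have h1 : (inner ℂ (Z (denRefl c W x)) (W x)).re = (inner ℂ (den c W x) (Z x)).re := by
    rw [den_apply, denRefl_apply, map_add, map_smul, map_smul, inner_add_left, inner_add_left,
      inner_smul_left, inner_smul_left, inner_smul_left, inner_smul_left, h.comm_apply,
      h.inner_snd]
    have e1 : (inner ℂ (Z x) x).re = (inner ℂ x (Z x)).re := inner_re_symm (𝕜 := ℂ) _ _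
    have e2 : (inner ℂ (Z x) (W x)).re = (inner ℂ (W x) (Z x)).re :=
      inner_re_symm (𝕜 := ℂ) _ _
    simp [e1, e2]
  simp only [RCLike.re_eq_complex_re, h1]

theorem norm_denInv_sq (h : IsShiftPair Z W) (hc : 0 < c) (x : H) :
    ‖x‖ ^ 2 = ‖denInv c W x‖ ^ 2 + (1 + c) * c * ‖denInv c W x + W (denInv c W x)‖ ^ 2 := by
  conv_lhs => rw [← h.den_denInv hc x]
  exact h.norm_den_sq _

theorem norm_denInv_le (h : IsShiftPair Z W) (hc : 0 < c) (x : H) : ‖denInv c W x‖ ≤ ‖x‖ := by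
  rw [← sq_le_sq₀ (norm_nonneg _) (norm_nonneg _), h.norm_denInv_sq hc x]
  exact le_add_of_nonneg_right (by positivity)

/-! ### Injectivity and dense ranges -/

theorem eq_zero_of_add_snd (h : IsShiftPair Z W) {x : H} (hx : x + W x = 0) : x = 0 := by
  refine h.eq_zero_of_adjoint x ?_
  have h1 : x = -W x := eq_neg_of_add_eq_zero_left hx
  conv_lhs => rw [h1]
  rw [map_neg, h.adjoint_snd_apply]

theorem pOp_injective (h : IsShiftPair Z W) (hc : 0 < c) : Function.Injective (pOp c Z W) := by
  rw [injective_iff_map_eq_zero]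
  intro x hx
  have h1 : den c W x = Z x := sub_eq_zero.1 hx
  have h2 := h.norm_den_sq (c := c) x
  rw [h1, h.norm_fst] at h2
  have h3 : (1 + c) * c * ‖x + W x‖ ^ 2 = 0 := by linarith
  have h4 : (1 + c) * c ≠ 0 := by positivity
  exact h.eq_zero_of_add_snd (by simpa [h4] using h3)

theorem adjoint_pOp (x : H) : adjoint (pOp c Z W) x =
    ((1 + c : ℝ) : ℂ) • x + (c : ℂ) • adjoint W x - adjoint Z x := by
  refine ext_inner_right ℂ fun y => ?_
  rw [adjoint_inner_left, pOp_apply, den_apply, inner_sub_right, inner_add_right,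
    inner_smul_right, inner_smul_right, inner_sub_left, inner_add_left, inner_smul_left,
    inner_smul_left, adjoint_inner_left, adjoint_inner_left, Complex.conj_ofReal,
    Complex.conj_ofReal]

/-- Since p(1, -1) = 0, dense range replaces invertibility of p(Z, W). Pairing the equation with x
gives Re⟨x, W*x⟩ ≤ -‖x‖², which for the contraction W* is possible only if W*x = -x. -/
theorem eq_zero_of_adjoint_pOp (h : IsShiftPair Z W) (hc : 0 < c) {x : H}
    (hx : adjoint (pOp c Z W) x = 0) : x = 0 := by
  refine h.eq_zero_of_adjoint x (eq_neg_of_add_eq_zero_left ?_)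
  have h1 := congr((inner ℂ x $hx).re)
  rw [adjoint_pOp, inner_sub_right, inner_add_right, inner_smul_right, inner_smul_right,
    inner_zero_right, Complex.sub_re, Complex.add_re, Complex.re_ofReal_mul,
    Complex.re_ofReal_mul, Complex.zero_re,
    (by simpa using inner_self_eq_norm_sq (𝕜 := ℂ) x : (inner ℂ x x).re = ‖x‖ ^ 2)] at h1
  have h2 : (inner ℂ x (adjoint Z x)).re ≤ ‖x‖ * ‖x‖ :=
    (re_inner_le_norm (𝕜 := ℂ) _ _).trans (by gcongr; exact norm_adjoint_apply_le h.fst x)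
  have h3 : ‖adjoint W x‖ ^ 2 ≤ ‖x‖ ^ 2 := by gcongr; exact norm_adjoint_apply_le h.snd x
  have h4 := norm_add_sq (𝕜 := ℂ) x (adjoint W x)
  rw [RCLike.re_eq_complex_re] at h4
  have h5 : c * (inner ℂ x (adjoint W x)).re ≤ c * (-‖x‖ ^ 2) := by nlinarith
  have h6 := le_of_mul_le_mul_left h5 hc
  have h7 : ‖x + adjoint W x‖ ^ 2 ≤ 0 := by linarith
  have h8 : ‖x + adjoint W x‖ = 0 := by nlinarith [norm_nonneg (x + adjoint W x)]
  rw [add_comm]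
  exact norm_eq_zero.1 h8

theorem denseRange_of_adjoint {T : H →L[ℂ] H} (hT : ∀ x, adjoint T x = 0 → x = 0) :
    DenseRange T := by
  have h1 : (LinearMap.range T.toLinearMap)ᗮ = ⊥ := by
    rw [Submodule.eq_bot_iff]
    intro x hx
    refine hT x (ext_inner_right ℂ fun y => ?_)
    rw [adjoint_inner_left, inner_zero_left]
    exact Submodule.inner_left_of_mem_orthogonal (LinearMap.mem_range_self T.toLinearMap y) hx
  have h2 := (Submodule.topologicalClosure_eq_top_iff (K := LinearMap.range T.toLinearMap)).2 h1
  have h3 := Submodule.dense_iff_topologicalClosure_eq_top.2 h2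
  exact h3

theorem denseRange_pOp (h : IsShiftPair Z W) (hc : 0 < c) : DenseRange (pOp c Z W) :=
  denseRange_of_adjoint fun _ hx => h.eq_zero_of_adjoint_pOp hc hx

theorem denseRange_one_add (h : IsShiftPair Z W) : DenseRange (1 + W : H →L[ℂ] H) :=
  denseRange_of_adjoint fun x hx => h.eq_zero_of_adjoint x <| by
    rw [map_add, show adjoint (1 : H →L[ℂ] H) = 1 from adjoint_id, add_comm] at hx
    exact eq_neg_of_add_eq_zero_left hx

/-! ### The inner function `θ = p̃ / p` of the pair -/

/-- The operator of multiplication by `θ = p̃ / p`. -/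
def _root_.BidiskShift.thetaOp (c : ℝ) (Z W : H →L[ℂ] H) : H →L[ℂ] H :=
  (pReflOp c Z W).toLinearMap.extendOfNorm (pOp c Z W).toLinearMap

theorem thetaOp_pOp (h : IsShiftPair Z W) (hc : 0 < c) (x : H) :
    thetaOp c Z W (pOp c Z W x) = pReflOp c Z W x :=
  LinearMap.extendOfNorm_eq (h.denseRange_pOp hc)
    ⟨1, fun y => by rw [one_mul]; exact (h.norm_pReflOp y).le⟩ x

theorem norm_thetaOp (h : IsShiftPair Z W) (hc : 0 < c) (x : H) :
    ‖thetaOp c Z W x‖ = ‖x‖ := by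
  refine (h.denseRange_pOp hc).induction_on (p := fun x => ‖thetaOp c Z W x‖ = ‖x‖) x
    (isClosed_eq (by fun_prop) (by fun_prop)) fun y => ?_
  rw [h.thetaOp_pOp hc, h.norm_pReflOp]

theorem commute_thetaOp (h : IsShiftPair Z W) (hc : 0 < c) {T : H →L[ℂ] H}
    (hZ : Commute T Z) (hW : Commute T W) : Commute T (thetaOp c Z W) := by
  ext x
  refine (h.denseRange_pOp hc).induction_on
    (p := fun x => (T * thetaOp c Z W) x = (thetaOp c Z W * T) x) x
    (isClosed_eq (by fun_prop) (by fun_prop)) fun y => ?_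
  have h1 : T (pOp c Z W y) = pOp c Z W (T y) := congr($((commute_pOp hZ hW).eq) y)
  have h2 : T (pReflOp c Z W y) = pReflOp c Z W (T y) := congr($((commute_pReflOp hZ hW).eq) y)
  change T (thetaOp c Z W _) = thetaOp c Z W (T _)
  rw [h1, h.thetaOp_pOp hc, h.thetaOp_pOp hc, h2]

theorem pOp_thetaOp (h : IsShiftPair Z W) (hc : 0 < c) (x : H) :
    pOp c Z W (thetaOp c Z W x) = pReflOp c Z W x := by
  rw [← h.thetaOp_pOp hc]
  exact congr($((h.commute_thetaOp hc (commute_pOp (Commute.refl Z) h.comm).symm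
    (commute_pOp h.comm.symm (Commute.refl W)).symm).eq) x)

/-- Recognises θG without dividing by p, using injectivity of p(Z, W). -/
theorem eq_thetaOp_of_pOp_eq (h : IsShiftPair Z W) (hc : 0 < c) {F G : H}
    (hFG : pOp c Z W F = pReflOp c Z W G) : F = thetaOp c Z W G :=
  h.pOp_injective hc (hFG.trans (h.pOp_thetaOp hc G).symm)

end IsShiftPair

end Abstract

/-! ### Multiplication by f on functions of the second variable. -/

section KernelPair

variable {H : Type*} [NormedAddCommGroup H] [InnerProductSpace ℂ H]

theorem den_snd {c : ℝ} {W : H →L[ℂ] H} (x : H) :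
    den c W (W x) = W (den c W x) := congr($((commute_den (Commute.refl W)).eq) x).symm

/-- Partial sums of the expansion of `f g` in powers of the first variable. -/
def kernelSum (c : ℝ) (Z W : H →L[ℂ] H) : ℕ → H → H
  | 0, _ => 0
  | n + 1, g => (√((1 + c) * c) : ℂ) • (denInv c W g + W (denInv c W g)) +
      Z (kernelSum c Z W n (denInv c W g))

theorem kernelSum_add {Z W : H →L[ℂ] H} {c : ℝ} (n m : ℕ) (g : H) : kernelSum c Z W (n + m) g =
    kernelSum c Z W n g + Z^[n] (kernelSum c Z W m ((denInv c W)^[n] g)) := by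
  induction n generalizing g with
  | zero => simp [kernelSum]
  | succ n ih =>
    rw [add_right_comm, kernelSum, kernelSum, ih, map_add, Function.iterate_succ_apply' Z,
      Function.iterate_succ_apply (denInv c W), add_assoc]

variable [CompleteSpace H]

theorem inner_apply_of_adjoint_eq_zero {T : H →L[ℂ] H} {y : H} (hy : adjoint T y = 0) (x : H) :
    inner ℂ (T x) y = 0 := by
  rw [← adjoint_inner_right, hy, inner_zero_right]

/-- `g` depends on the second variable only and `h = f g`, where `f = √(a c) (1 + z₂) / p`. -/
structure IsKernelPair (c : ℝ) (Z W : H →L[ℂ] H) (g h : H) : Prop where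
  adjoint_eq_zero : adjoint Z g = 0
  pOp_eq : pOp c Z W h = (√((1 + c) * c) : ℂ) • (g + W g)

namespace IsShiftPair

variable {Z W : H →L[ℂ] H} {c : ℝ}

theorem denInv_snd (h : IsShiftPair Z W) (hc : 0 < c) (x : H) :
    denInv c W (W x) = W (denInv c W x) :=
  congr($((h.commute_denInv hc (Commute.refl W)).eq) x).symm

theorem denInv_fst (h : IsShiftPair Z W) (hc : 0 < c) (x : H) :
    denInv c W (Z x) = Z (denInv c W x) :=
  congr($((h.commute_denInv hc h.comm).eq) x).symm

theorem adjoint_denInv (h : IsShiftPair Z W) (hc : 0 < c) (x : H) :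
    adjoint Z (denInv c W x) = denInv c W (adjoint Z x) :=
  congr($((h.commute_denInv hc h.adjoint_comm).eq) x)

theorem denRefl_fst (h : IsShiftPair Z W) (x : H) :
    denRefl c W (Z x) = Z (denRefl c W x) := congr($((commute_denRefl h.comm).eq) x).symm

theorem den_fst (h : IsShiftPair Z W) (x : H) :
    den c W (Z x) = Z (den c W x) := congr($((commute_den h.comm).eq) x).symm

/-- The squared norms of D⁻ⁿg decrease, hence converge, and by `norm_denInv_sq` their successive
differences are (1 + c)c‖(1 + W)D⁻ⁿ⁻¹g‖². -/
theorem tendsto_denInv_add (h : IsShiftPair Z W) (hc : 0 < c) (g : H) :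
    Tendsto (fun n => (denInv c W)^[n] g + W ((denInv c W)^[n] g)) atTop (𝓝 0) := by
  have h1 : Antitone fun n => ‖(denInv c W)^[n] g‖ ^ 2 := antitone_nat_of_succ_le fun n => by
    rw [Function.iterate_succ_apply']
    gcongr
    exact h.norm_denInv_le hc _
  have h2 := tendsto_atTop_ciInf h1 ⟨0, by rintro _ ⟨n, rfl⟩; positivity⟩
  have h3 : ∀ n, ‖(denInv c W)^[n + 1] g + W ((denInv c W)^[n + 1] g)‖ =
      √((‖(denInv c W)^[n] g‖ ^ 2 - ‖(denInv c W)^[n + 1] g‖ ^ 2) / ((1 + c) * c)) := fun n => by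
    rw [Function.iterate_succ_apply', h.norm_denInv_sq hc ((denInv c W)^[n] g),
      add_sub_cancel_left, mul_div_cancel_left₀ _ (mul_pos (by linarith) hc).ne',
      Real.sqrt_sq (norm_nonneg _)]
  rw [← tendsto_add_atTop_iff_nat 1, tendsto_zero_iff_norm_tendsto_zero]
  simp only [h3]
  have h4 := ((h2.sub (h2.comp (tendsto_add_atTop_nat 1))).div_const ((1 + c) * c)).sqrt
  rw [sub_self, zero_div, Real.sqrt_zero] at h4
  exact h4

/-- The previous limit gives D⁻ⁿ → 0 on the range of 1 + W. That range is dense and the D⁻ⁿ are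
contractions. -/
theorem tendsto_denInv (h : IsShiftPair Z W) (hc : 0 < c) (g : H) :
    Tendsto (fun n => (denInv c W)^[n] g) atTop (𝓝 0) := by
  have h1 : ∀ n x y, (denInv c W)^[n] (x + y) = (denInv c W)^[n] x + (denInv c W)^[n] y :=
    fun n => iterate_map_add (denInv c W) n
  have h2 : ∀ n x, ‖(denInv c W)^[n] x‖ ≤ ‖x‖ := fun n x => by
    induction n with
    | zero => exact le_rfl
    | succ n ih => rw [Function.iterate_succ_apply']; exact (h.norm_denInv_le hc _).trans ih
  have h3 : ∀ n x, (denInv c W)^[n] (W x) = W ((denInv c W)^[n] x) := fun n x =>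
    ((show Function.Semiconj W (denInv c W) (denInv c W) from
      fun x => (h.denInv_snd hc x).symm).iterate_right n x).symm
  rw [Metric.tendsto_atTop]
  intro ε hε
  obtain ⟨y, hy⟩ := h.denseRange_one_add.exists_dist_lt g (half_pos hε)
  obtain ⟨N, hN⟩ := Metric.tendsto_atTop.1 (h.tendsto_denInv_add hc y) (ε / 2) (half_pos hε)
  refine ⟨N, fun n hn => ?_⟩
  have h4 := hN n hn
  rw [dist_zero_right] at h4 ⊢
  rw [dist_eq_norm] at hy
  have h5 : g = (g - (1 + W : H →L[ℂ] H) y) + (y + W y) := (sub_add_cancel g (y + W y)).symm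
  rw [h5, h1, h1, h3]
  exact (norm_add_le _ _).trans_lt (by linarith [h2 n (g - (1 + W : H →L[ℂ] H) y)])

/-- The leading term is killed by Z*, so it is orthogonal to the rest; `norm_denInv_sq` then makes
the sum telescope. -/
theorem norm_kernelSum_sq (h : IsShiftPair Z W) (hc : 0 < c) (n : ℕ) (g : H)
    (hg : adjoint Z g = 0) :
    ‖kernelSum c Z W n g‖ ^ 2 = ‖g‖ ^ 2 - ‖(denInv c W)^[n] g‖ ^ 2 := by
  induction n generalizing g with
  | zero => simp [kernelSum]
  | succ n ih =>
    have h1 : adjoint Z (denInv c W g) = 0 := by rw [h.adjoint_denInv hc, hg, map_zero]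
    rw [kernelSum, norm_add_sq (𝕜 := ℂ), h.norm_fst, ih _ h1, ← adjoint_inner_left, map_smul,
      map_add, h.adjoint_comm_apply, h1, h.norm_denInv_sq hc g, norm_smul, mul_pow,
      Function.iterate_succ_apply, Complex.norm_real, Real.norm_eq_abs, sq_abs,
      Real.sq_sqrt (by positivity)]
    simp only [map_zero, add_zero, smul_zero, inner_zero_left, mul_zero]
    ring

theorem pOp_kernelSum (h : IsShiftPair Z W) (hc : 0 < c) (n : ℕ) (g : H) :
    pOp c Z W (kernelSum c Z W n g) = (√((1 + c) * c) : ℂ) • (g + W g) -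
      Z^[n] ((√((1 + c) * c) : ℂ) • ((denInv c W)^[n] g + W ((denInv c W)^[n] g))) := by
  induction n generalizing g with
  | zero => simp [kernelSum]
  | succ n ih =>
    have h1 : ∀ x, pOp c Z W (Z x) = Z (pOp c Z W x) := fun x => by
      rw [pOp_apply, pOp_apply, h.den_fst, map_sub]
    rw [kernelSum, map_add, h1, ih, pOp_apply, map_smul, map_add, den_snd, h.den_denInv hc,
      map_sub, Function.iterate_succ_apply' Z, Function.iterate_succ_apply (denInv c W)]
    abel

/-- The product f g is the series obtained by expanding 1 / (D - z₁) in powers of z₁. Its blocks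
from index n on have norm at most ‖D⁻ⁿg‖, which tends to 0; this gives convergence and the full norm
‖g‖. -/
theorem exists_isKernelPair (h : IsShiftPair Z W) (hc : 0 < c) {g : H} (hg : adjoint Z g = 0) :
    ∃ x, IsKernelPair c Z W g x ∧ ‖x‖ = ‖g‖ := by
  have hZ : ∀ n x, ‖Z^[n] x‖ = ‖x‖ := fun n x => by
    induction n with
    | zero => rfl
    | succ n ih => rw [Function.iterate_succ_apply', h.norm_fst, ih]
  have hU : ∀ n, adjoint Z ((denInv c W)^[n] g) = 0 := fun n => by
    induction n with
    | zero => exact hg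
    | succ n ih => rw [Function.iterate_succ_apply', h.adjoint_denInv hc, ih, map_zero]
  have h0 : Tendsto (fun n => ‖(denInv c W)^[n] g‖) atTop (𝓝 0) :=
    tendsto_zero_iff_norm_tendsto_zero.1 (h.tendsto_denInv hc g)
  have h1 : CauchySeq fun n => kernelSum c Z W n g := by
    refine cauchySeq_of_le_tendsto_0' _ (fun n m hnm => ?_) h0
    obtain ⟨k, rfl⟩ := Nat.exists_eq_add_of_le hnm
    rw [dist_comm, dist_eq_norm, kernelSum_add, add_sub_cancel_left, hZ,
      ← sq_le_sq₀ (norm_nonneg _) (norm_nonneg _), h.norm_kernelSum_sq hc _ _ (hU n)]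
    exact sub_le_self _ (by positivity)
  obtain ⟨x, hx⟩ := cauchySeq_tendsto_of_complete h1
  refine ⟨x, ⟨hg, ?_⟩, ?_⟩
  · refine tendsto_nhds_unique (((pOp c Z W).continuous.tendsto x).comp hx) ?_
    rw [tendsto_iff_norm_sub_tendsto_zero]
    have h2 := ((tendsto_zero_iff_norm_tendsto_zero.1 (h.tendsto_denInv_add hc g))).const_mul
      (√((1 + c) * c))
    rw [mul_zero] at h2
    refine h2.congr fun n => ?_
    rw [Function.comp_apply, h.pOp_kernelSum hc, sub_sub_cancel_left, norm_neg, hZ, norm_smul,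
      Complex.norm_real, Real.norm_eq_abs, abs_of_nonneg (Real.sqrt_nonneg _)]
  · rw [← sq_eq_sq₀ (norm_nonneg _) (norm_nonneg _)]
    refine tendsto_nhds_unique (hx.norm.pow 2) ?_
    have h2 := (h0.pow 2).const_sub (‖g‖ ^ 2)
    rw [zero_pow two_ne_zero, sub_zero] at h2
    exact h2.congr fun n => (h.norm_kernelSum_sq hc n g hg).symm

/-- This is D*W = D̃, with D̃ = `denRefl c W`, a consequence of W*W = 1. -/
theorem inner_snd_den (h : IsShiftPair Z W) (x y : H) :
    inner ℂ (W x) (den c W y) = inner ℂ (denRefl c W x) y := by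
  rw [den_apply, denRefl_apply, inner_add_right, inner_add_left, inner_smul_right,
    inner_smul_right, inner_smul_left, inner_smul_left, h.inner_snd, Complex.conj_ofReal,
    Complex.conj_ofReal]

theorem inner_thetaOp (h : IsShiftPair Z W) (hc : 0 < c) (x y : H) :
    inner ℂ (thetaOp c Z W x) (thetaOp c Z W y) = inner ℂ x y := by
  have := LinearIsometry.inner_map_map
    (⟨(thetaOp c Z W).toLinearMap, h.norm_thetaOp hc⟩ : H →ₗᵢ[ℂ] H) x y
  exact this

theorem fst_thetaOp (h : IsShiftPair Z W) (hc : 0 < c) (x : H) :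
    Z (thetaOp c Z W x) = thetaOp c Z W (Z x) :=
  congr($((h.commute_thetaOp hc (Commute.refl Z) h.comm).eq) x)

end IsShiftPair

/-! ### Action of Z and its adjoint on the functions f g. -/

namespace IsKernelPair

variable {Z W : H →L[ℂ] H} {c : ℝ} {g g' x x' : H}

theorem add (hx : IsKernelPair c Z W g x) (hx' : IsKernelPair c Z W g' x') :
    IsKernelPair c Z W (g + g') (x + x') where
  adjoint_eq_zero := by rw [map_add, hx.1, hx'.1, add_zero]
  pOp_eq := by rw [map_add, hx.2, hx'.2, ← smul_add, map_add, add_add_add_comm]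

theorem smul (hx : IsKernelPair c Z W g x) (r : ℂ) : IsKernelPair c Z W (r • g) (r • x) where
  adjoint_eq_zero := by rw [map_smul, hx.1, smul_zero]
  pOp_eq := by rw [map_smul, hx.2, map_smul, ← smul_add, smul_comm]

theorem zero : IsKernelPair c Z W 0 0 := ⟨by simp, by simp⟩

theorem norm_eq (hx : IsKernelPair c Z W g x) (h : IsShiftPair Z W) (hc : 0 < c) :
    ‖x‖ = ‖g‖ := by
  obtain ⟨y, hy, hy'⟩ := h.exists_isKernelPair hc hx.1
  rw [h.pOp_injective hc (hx.2.trans hy.2.symm), hy']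

/-- Polarization, since kernel pairs are closed under linear combinations. -/
theorem inner_eq (hx : IsKernelPair c Z W g x) (hx' : IsKernelPair c Z W g' x')
    (h : IsShiftPair Z W) (hc : 0 < c) : inner ℂ x x' = inner ℂ g g' := by
  have h1 : ∀ r : ℂ, ‖x + r • x'‖ = ‖g + r • g'‖ := fun r => (hx.add (hx'.smul r)).norm_eq h hc
  have h2 := h1 1
  have h3 := h1 (-1)
  have h4 := h1 Complex.I
  have h5 := h1 (-Complex.I)
  simp only [neg_smul, one_smul, ← sub_eq_add_neg] at h2 h3 h4 h5
  rw [inner_eq_sum_norm_sq_div_four, inner_eq_sum_norm_sq_div_four]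
  simp only [RCLike.I_to_complex, h2, h3, h4, h5]

theorem map_denInv (hx : IsKernelPair c Z W g x) (h : IsShiftPair Z W) (hc : 0 < c) :
    IsKernelPair c Z W (denInv c W g) (denInv c W x) where
  adjoint_eq_zero := by rw [h.adjoint_denInv hc, hx.1, map_zero]
  pOp_eq := by
    have h1 : denInv c W (pOp c Z W x) = denInv c W ((√((1 + c) * c) : ℂ) • (g + W g)) := by
      rw [hx.2]
    rw [pOp_apply, map_sub, h.denInv_fst hc, h.denInv_den hc, map_smul, map_add,
      h.denInv_snd hc] at h1
    rw [pOp_apply, h.den_denInv hc, h1]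

/-- The component of `f g` which does not depend on the first variable. -/
def _root_.BidiskShift.kernelConst (c : ℝ) (W : H →L[ℂ] H) (g : H) : H :=
  (√((1 + c) * c) : ℂ) • (denInv c W g + W (denInv c W g))

theorem eq_add (hx : IsKernelPair c Z W g x) (h : IsShiftPair Z W) (hc : 0 < c) :
    x = Z (denInv c W x) + kernelConst c W g := by
  have h1 := (hx.map_denInv h hc).2
  rw [pOp_apply, h.den_denInv hc, sub_eq_iff_eq_add'] at h1
  exact h1

theorem adjoint_kernelConst (hx : IsKernelPair c Z W g x) (h : IsShiftPair Z W) (hc : 0 < c) :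
    adjoint Z (kernelConst c W g) = 0 := by
  rw [kernelConst, map_smul, map_add, h.adjoint_comm_apply, (hx.map_denInv h hc).1]
  simp

theorem den_kernelConst (hx : IsKernelPair c Z W g x) (h : IsShiftPair Z W) (hc : 0 < c) :
    den c W (kernelConst c W g) = den c W x - Z x := by
  rw [kernelConst, map_smul, map_add, den_snd, h.den_denInv hc, ← hx.2, pOp_apply]

/-- Apply Z* to x = Z D⁻¹x + k, where Z*k = 0. This turns the first shift into a function of W. -/
theorem adjoint_apply (hx : IsKernelPair c Z W g x) (h : IsShiftPair Z W) (hc : 0 < c) :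
    adjoint Z x = denInv c W x := by
  conv_lhs => rw [hx.eq_add h hc]
  rw [map_add, hx.adjoint_kernelConst h hc, h.adjoint_fst_apply, add_zero]

theorem inner_fst_self (hx : IsKernelPair c Z W g x) (h : IsShiftPair Z W) (hc : 0 < c) :
    inner ℂ x (Z x) = inner ℂ (denInv c W x) x := by
  rw [← adjoint_inner_left, hx.adjoint_apply h hc]

theorem norm_kernelConst_sq (hx : IsKernelPair c Z W g x) (h : IsShiftPair Z W) (hc : 0 < c) :
    ‖kernelConst c W g‖ ^ 2 = (1 + c) * c *
      ‖denInv c W x + W (denInv c W x)‖ ^ 2 := by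
  have h1 := h.norm_denInv_sq hc x
  have h2 := congr(‖$(hx.eq_add h hc)‖ ^ 2)
  rw [norm_add_sq (𝕜 := ℂ), ← adjoint_inner_right, hx.adjoint_kernelConst h hc,
    inner_zero_right, h.norm_fst, map_zero] at h2
  linarith

/-- On the dense set of vectors p y, the inner product is ⟨D̃y, D⁻¹x⟩ - ⟨Wy, x⟩, and the two terms
agree because D*W = D̃. -/
theorem inner_thetaOp_left (hx : IsKernelPair c Z W g x) (h : IsShiftPair Z W) (hc : 0 < c)
    (y : H) : inner ℂ (thetaOp c Z W y) x = 0 := by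
  refine (h.denseRange_pOp hc).induction_on (p := fun y => inner ℂ (thetaOp c Z W y) x = 0) y
    (isClosed_eq (by fun_prop) (by fun_prop)) fun y => ?_
  rw [h.thetaOp_pOp hc, pReflOp_apply, inner_sub_left, ← adjoint_inner_right,
    hx.adjoint_apply h hc, ← h.inner_snd_den, h.den_denInv hc, sub_self]

/-- Checked on vectors p y: the term of D̃D⁻¹p y lying in the range of Z is orthogonal to k, and Dk
= Dx - Zx matches the rest. -/
theorem inner_thetaOp_fst (hx : IsKernelPair c Z W g x) (h : IsShiftPair Z W) (hc : 0 < c)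
    (y : H) : inner ℂ (thetaOp c Z W y) (Z x) =
      inner ℂ (denRefl c W (denInv c W y)) (kernelConst c W g) := by
  refine (h.denseRange_pOp hc).induction_on (p := fun y => inner ℂ (thetaOp c Z W y) (Z x) =
      inner ℂ (denRefl c W (denInv c W y)) (kernelConst c W g)) y
    (isClosed_eq (by fun_prop) (by fun_prop)) fun y => ?_
  rw [h.thetaOp_pOp hc, pReflOp_apply, pOp_apply, inner_sub_left, h.inner_fst, map_sub, map_sub,
    h.denInv_den hc, h.denInv_fst hc, h.denRefl_fst, inner_sub_left,
    inner_apply_of_adjoint_eq_zero (hx.adjoint_kernelConst h hc), sub_zero, ← h.inner_snd_den, ← h.inner_snd_den,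
    hx.den_kernelConst h hc, inner_sub_right]

end IsKernelPair

/-! ### Sums `x₁ + θ₁ x₂` -/

section Sum

variable {Z W : H →L[ℂ] H} {c₁ c₂ : ℝ} {g₁ g₂ x₁ x₂ : H}

theorem IsKernelPair.norm_add_thetaOp_sq (h : IsShiftPair Z W) (hc₁ : 0 < c₁)
    (hx₁ : IsKernelPair c₁ Z W g₁ x₁) (y : H) :
    ‖x₁ + thetaOp c₁ Z W y‖ ^ 2 = ‖x₁‖ ^ 2 + ‖y‖ ^ 2 := by
  rw [norm_add_sq (𝕜 := ℂ), inner_eq_zero_symm.1 (hx₁.inner_thetaOp_left h hc₁ y),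
    h.norm_thetaOp hc₁]
  simp

/-- Only one cross term survives: Zθ₁x₂ = θ₁Zx₂ is orthogonal to x₁. In the other one the summand Z
D₂⁻¹x₂ of x₂ drops out against k₁. -/
theorem IsKernelPair.inner_add_thetaOp (h : IsShiftPair Z W) (hc₁ : 0 < c₁) (hc₂ : 0 < c₂)
    (hx₁ : IsKernelPair c₁ Z W g₁ x₁) (hx₂ : IsKernelPair c₂ Z W g₂ x₂) :
    inner ℂ (x₁ + thetaOp c₁ Z W x₂) (Z (x₁ + thetaOp c₁ Z W x₂)) =
      inner ℂ (denInv c₁ W x₁) x₁ + inner ℂ (denInv c₂ W x₂) x₂ +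
        inner ℂ (denRefl c₁ W (denInv c₁ W (kernelConst c₂ W g₂))) (kernelConst c₁ W g₁) := by
  have h1 : inner ℂ (thetaOp c₁ Z W x₂) (Z x₁) =
      inner ℂ (denRefl c₁ W (denInv c₁ W (kernelConst c₂ W g₂))) (kernelConst c₁ W g₁) := by
    rw [hx₁.inner_thetaOp_fst h hc₁]
    conv_lhs => rw [hx₂.eq_add h hc₂]
    rw [map_add, map_add, h.denInv_fst hc₁, h.denRefl_fst, inner_add_left,
      inner_apply_of_adjoint_eq_zero (hx₁.adjoint_kernelConst h hc₁), zero_add]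
  rw [map_add, inner_add_left, inner_add_right, inner_add_right, h1, h.fst_thetaOp hc₁,
    h.inner_thetaOp hc₁, inner_eq_zero_symm.1 (hx₁.inner_thetaOp_left h hc₁ _),
    hx₁.inner_fst_self h hc₁, hx₂.inner_fst_self h hc₂]
  ring

end Sum



end KernelPair

/-! ### Lower bound for the real part, and the form on kernel functions. -/

section Estimates

variable {H : Type*} [NormedAddCommGroup H] [InnerProductSpace ℂ H] [CompleteSpace H]
  {Z W : H →L[ℂ] H} {c c₁ c₂ : ℝ} {g g₁ g₂ x x₁ x₂ κ : H}

theorem IsShiftPair.norm_add_snd_sq_le (h : IsShiftPair Z W) (x : H) :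
    ‖x + W x‖ ^ 2 ≤ 4 * ‖x‖ ^ 2 := by
  have h1 := norm_add_le x (W x)
  rw [h.norm_snd] at h1
  nlinarith [norm_nonneg (x + W x)]

theorem IsShiftPair.re_inner_denInv (h : IsShiftPair Z W) (hc : 0 < c) (x : H) :
    (inner ℂ (denInv c W x) x).re =
      ‖denInv c W x‖ ^ 2 + c / 2 * ‖denInv c W x + W (denInv c W x)‖ ^ 2 := by
  have h1 : inner ℂ (denInv c W x) x = inner ℂ (denInv c W x) (den c W (denInv c W x)) := by
    rw [h.den_denInv hc]
  rw [h1, den_apply, inner_add_right, inner_smul_right, inner_smul_right, h.norm_add_snd_sq,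
    Complex.add_re, Complex.re_ofReal_mul, Complex.re_ofReal_mul,
    (by simpa using inner_self_eq_norm_sq (𝕜 := ℂ) (denInv c W x) :
      (inner ℂ (denInv c W x) (denInv c W x)).re = ‖denInv c W x‖ ^ 2)]
  ring

/-- The quadratic form inequality behind the lower bound of the numerical range. -/
theorem quadratic_bound {c₁ c₂ δ X₁ X₂ q₁ q₂ γ₁ γ₂ : ℝ} (hc₁ : 0 < c₁) (hc₂ : 0 < c₂)
    (hδ : 0 ≤ δ) (hδ' : δ ≤ 1)
    (hc : 4 * ((1 + c₁) * c₁) * ((1 + c₂) * c₂) ≤ (1 - δ) ^ 2 * ((1 + 2 * c₁) * (1 + 2 * c₂)))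
    (hq₁ : 0 ≤ q₁) (hq₂ : 0 ≤ q₂)
    (hX₁ : q₁ ≤ 4 * X₁) (hX₂ : q₂ ≤ 4 * X₂)
    (hγ₁ : γ₁ ^ 2 = (1 + c₁) * c₁ * q₁) (hγ₂ : γ₂ ^ 2 = (1 + c₂) * c₂ * q₂) :
    δ / (2 * (1 + c₁) * (1 + c₂)) *
      ((X₁ + (1 + c₁) * c₁ * q₁) + (X₂ + (1 + c₂) * c₂ * q₂)) ≤
      (X₁ + c₁ / 2 * q₁) + (X₂ + c₂ / 2 * q₂) - γ₂ * γ₁ := by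
  -- AM-GM on (1 + 2c_j)q_j / 4 ≤ X_j + c_j q_j / 2, which is where q_j ≤ 4X_j enters.
  have h1 : γ₂ * γ₁ ≤ (1 - δ) * ((X₁ + c₁ / 2 * q₁) + (X₂ + c₂ / 2 * q₂)) := by
    refine abs_le_of_sq_le_sq' ?_ (by
      refine mul_nonneg (by linarith) ?_
      have := mul_nonneg hc₁.le hq₁
      have := mul_nonneg hc₂.le hq₂
      linarith) |>.2
    have h2 : 4 * (γ₂ * γ₁) ^ 2 ≤ (1 - δ) ^ 2 * ((1 + 2 * c₁) * (1 + 2 * c₂)) * (q₁ * q₂) := by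
      calc 4 * (γ₂ * γ₁) ^ 2 = 4 * ((1 + c₁) * c₁) * ((1 + c₂) * c₂) * (q₁ * q₂) := by
            rw [mul_pow, hγ₁, hγ₂]; ring
        _ ≤ _ := by gcongr
    have h3 : 4 * (((1 + 2 * c₁) * q₁ / 4) * ((1 + 2 * c₂) * q₂ / 4)) ≤
        ((X₁ + c₁ / 2 * q₁) + (X₂ + c₂ / 2 * q₂)) ^ 2 := by
      have h4 : (1 + 2 * c₁) * q₁ / 4 ≤ X₁ + c₁ / 2 * q₁ := by linarith
      have h5 : (1 + 2 * c₂) * q₂ / 4 ≤ X₂ + c₂ / 2 * q₂ := by linarith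
      have h6 : 0 ≤ (1 + 2 * c₁) * q₁ / 4 := by positivity
      have h7 : 0 ≤ (1 + 2 * c₂) * q₂ / 4 := by positivity
      calc _ ≤ ((1 + 2 * c₁) * q₁ / 4 + (1 + 2 * c₂) * q₂ / 4) ^ 2 := by
            nlinarith [sq_nonneg ((1 + 2 * c₁) * q₁ / 4 - (1 + 2 * c₂) * q₂ / 4)]
        _ ≤ _ := by gcongr
    rw [mul_pow]
    have h8 := mul_le_mul_of_nonneg_left h3 (sq_nonneg (1 - δ))
    linarith
  -- The remaining fraction δ controls the norm: ‖x‖² = X + (1 + c)c q is at most 2(1 + c)(X + c q /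
  -- 2). The extra factor 1 + c' only makes the constant symmetric.
  have h9 : ∀ {c c' X q : ℝ}, 0 < c → 0 < c' → 0 ≤ q → q ≤ 4 * X →
      δ / (2 * (1 + c) * (1 + c')) * (X + (1 + c) * c * q) ≤ δ * (X + c / 2 * q) := by
    intro c c' X q hc hc' hq hX
    rw [div_mul_eq_mul_div, div_le_iff₀ (by positivity), mul_assoc δ (X + c / 2 * q)]
    refine mul_le_mul_of_nonneg_left ?_ hδ
    have h10 : X + (1 + c) * c * q ≤ (X + c / 2 * q) * (2 * (1 + c)) := by
      nlinarith [mul_nonneg hc.le (show (0 : ℝ) ≤ X by linarith)]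
    have h11 : 0 ≤ (X + c / 2 * q) * (2 * (1 + c)) := by
      have : 0 ≤ X := by linarith
      positivity
    nlinarith [mul_nonneg h11 hc'.le]
  have h12 := h9 hc₁ hc₂ hq₁ hX₁
  have h13 := h9 hc₂ hc₁ hq₂ hX₂
  rw [mul_right_comm 2 (1 + c₂)] at h13
  linarith

/-- The lower bound of the real part of the numerical range. -/
theorem IsKernelPair.le_re_inner_add_thetaOp (h : IsShiftPair Z W) {δ : ℝ} (hc₁ : 0 < c₁)
    (hc₂ : 0 < c₂) (hδ : 0 ≤ δ) (hδ' : δ ≤ 1)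
    (hc : 4 * ((1 + c₁) * c₁) * ((1 + c₂) * c₂) ≤ (1 - δ) ^ 2 * ((1 + 2 * c₁) * (1 + 2 * c₂)))
    (hx₁ : IsKernelPair c₁ Z W g₁ x₁) (hx₂ : IsKernelPair c₂ Z W g₂ x₂) :
    δ / (2 * (1 + c₁) * (1 + c₂)) * ‖x₁ + thetaOp c₁ Z W x₂‖ ^ 2 ≤
      (inner ℂ (x₁ + thetaOp c₁ Z W x₂) (Z (x₁ + thetaOp c₁ Z W x₂))).re := by
  rw [hx₁.inner_add_thetaOp h hc₁ hc₂ hx₂, hx₁.norm_add_thetaOp_sq h hc₁, Complex.add_re,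
    Complex.add_re, h.re_inner_denInv hc₁, h.re_inner_denInv hc₂, h.norm_denInv_sq hc₁ x₁,
    h.norm_denInv_sq hc₂ x₂]
  refine (quadratic_bound hc₁ hc₂ hδ hδ' hc (by positivity) (by positivity)
    (h.norm_add_snd_sq_le _) (h.norm_add_snd_sq_le _) (hx₁.norm_kernelConst_sq h hc₁)
    (hx₂.norm_kernelConst_sq h hc₂)).trans ?_
  rw [sub_eq_add_neg]
  gcongr
  -- Cauchy–Schwarz on the cross term; D̃₁D₁⁻¹ is isometric by `norm_denRefl`.
  have h1 := (Complex.abs_re_le_norm _).trans (norm_inner_le_norm (𝕜 := ℂ)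
    (denRefl c₁ W (denInv c₁ W (kernelConst c₂ W g₂))) (kernelConst c₁ W g₁))
  rw [h.norm_denRefl, h.den_denInv hc₁] at h1
  exact (abs_le.1 h1).1

/-! ### Eigenvectors of the adjoint -/

section Eigen

variable {w : ℝ}

theorem inner_snd_of_eigen (hκ : adjoint W κ = (w : ℂ) • κ) (y : H) :
    inner ℂ (W y) κ = w * inner ℂ y κ := by
  rw [← adjoint_inner_right, hκ, inner_smul_right]

theorem IsShiftPair.inner_denInv_of_eigen (h : IsShiftPair Z W) (hc : 0 < c) (hw : 0 ≤ w)
    (hκ : adjoint W κ = (w : ℂ) • κ) (y : H) :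
    inner ℂ (denInv c W y) κ = ((1 / (1 + c + c * w) : ℝ) : ℂ) * inner ℂ y κ := by
  have h1 : inner ℂ y κ = ((1 + c + c * w : ℝ) : ℂ) * inner ℂ (denInv c W y) κ := by
    conv_lhs => rw [← h.den_denInv hc y]
    rw [den_apply, inner_add_left, inner_smul_left, inner_smul_left, inner_snd_of_eigen hκ,
      Complex.conj_ofReal, Complex.conj_ofReal]
    push_cast
    ring
  have h2 : (1 + c + c * w : ℝ) ≠ 0 := by positivity
  rw [h1, ← mul_assoc, ← Complex.ofReal_mul, one_div_mul_cancel h2, Complex.ofReal_one, one_mul]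

/-- The coefficients of the compression to the span of `f₁ κ` and `θ₁ f₂ κ`. -/
theorem IsKernelPair.inner_add_thetaOp_of_eigen (h : IsShiftPair Z W) (hc₁ : 0 < c₁)
    (hc₂ : 0 < c₂) (hw : 0 ≤ w) (hκ : adjoint W κ = (w : ℂ) • κ) (hκ' : ‖κ‖ = 1)
    (hx₁ : IsKernelPair c₁ Z W κ x₁) (hx₂ : IsKernelPair c₂ Z W κ x₂) (r s : ℂ) :
    inner ℂ (r • x₁ + thetaOp c₁ Z W (s • x₂)) (Z (r • x₁ + thetaOp c₁ Z W (s • x₂))) =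
      ((1 / (1 + c₁ + c₁ * w) : ℝ) : ℂ) * (‖r‖ : ℂ) ^ 2 +
      ((1 / (1 + c₂ + c₂ * w) : ℝ) : ℂ) * (‖s‖ : ℂ) ^ 2 +
      ((√((1 + c₁) * c₁) * √((1 + c₂) * c₂) * (1 + w) ^ 2 * (1 / (1 + c₁ + c₁ * w)) *
        (1 / (1 + c₂ + c₂ * w)) : ℝ) : ℂ) * (r * conj s) := by
  have h1 : inner ℂ κ κ = 1 := by rw [inner_self_eq_norm_sq_to_K, hκ']; simp
  have h2 : ∀ {c : ℝ} {x : H} (t : ℂ), 0 < c → IsKernelPair c Z W κ x →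
      inner ℂ (denInv c W (t • x)) (t • x) =
        ((1 / (1 + c + c * w) : ℝ) : ℂ) * (‖t‖ : ℂ) ^ 2 := by
    intro c x t hc hx
    rw [map_smul, inner_smul_left, inner_smul_right, (hx.map_denInv h hc).inner_eq hx h hc,
      h.inner_denInv_of_eigen hc hw hκ, h1, mul_one, ← Complex.conj_mul']
    ring
  rw [(hx₁.smul r).inner_add_thetaOp h hc₁ hc₂ (hx₂.smul s), h2 r hc₁ hx₁, h2 s hc₂ hx₂]
  congr 1
  -- This gives one factor 1 + w of the cross term; the other comes from 1 + W in `kernelConst`.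
  have h3 : ∀ y, inner ℂ (W y) (κ + W κ) = (1 + w : ℂ) * inner ℂ y κ := fun y => by
    rw [inner_add_right, h.inner_snd, inner_snd_of_eigen hκ]
    ring
  rw [← h.inner_snd_den, (hx₁.smul r).den_kernelConst h hc₁, ← pOp_apply, (hx₁.smul r).2,
    map_smul, ← smul_add, inner_smul_right, inner_smul_right, h3, h.inner_denInv_of_eigen hc₁ hw hκ,
    kernelConst, map_smul, map_smul, ← smul_add, inner_smul_left, inner_smul_left,
    inner_add_left, inner_snd_of_eigen hκ, h.inner_denInv_of_eigen hc₂ hw hκ, h1,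
    Complex.conj_ofReal]
  push_cast
  ring

end Eigen

end Estimates

/-! ### Uniqueness of Taylor coefficients -/

theorem eq_zero_of_forall_tsum_eq_zero {a : ℕ → ℂ} {C : ℝ} (ha : ∀ n, ‖a n‖ ≤ C)
    (h : ∀ z : ℂ, ‖z‖ < 1 → ∑' n, a n * z ^ n = 0) (n : ℕ) : a n = 0 := by
  have h1 : HasFPowerSeriesAt (0 : ℂ → ℂ) (FormalMultilinearSeries.ofScalars ℂ a) 0 := by
    rw [hasFPowerSeriesAt_iff]
    filter_upwards [Metric.ball_mem_nhds (0 : ℂ) one_pos] with z hz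
    have hz' : ‖z‖ < 1 := by simpa using hz
    have h2 : Summable fun n => a n * z ^ n :=
      Summable.of_norm_bounded ((summable_geometric_of_lt_one (norm_nonneg z) hz').mul_left C)
        fun n => by
          rw [norm_mul, norm_pow]
          gcongr
          exact ha n
    have h3 := h2.hasSum
    rw [h z hz'] at h3
    simpa [FormalMultilinearSeries.coeff_ofScalars, mul_comm] using h3
  have h4 := congr(FormalMultilinearSeries.coeff $h1.eq_zero n)
  rw [FormalMultilinearSeries.coeff_ofScalars] at h4
  exact h4

/-- One-variable uniqueness used twice: in z₁ with z₂ = w fixed, then in w for each coefficient. -/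
theorem Hardy.eq_zero_of_eval (F : Hardy) (h : ∀ z ∈ bidisk, F.eval z = 0) : F = 0 := by
  have hF : ∀ k, ‖F k‖ ≤ ‖F‖ := fun k => lp.norm_apply_le_norm (by norm_num) F k
  have h1 : ∀ w : ℂ, ‖w‖ < 1 → ∀ m, ∑' n, F (m, n) * w ^ n = 0 := by
    intro w hw
    have hg := (summable_geometric_of_lt_one (norm_nonneg w) hw).mul_left ‖F‖
    have hb : ∀ m n, ‖F (m, n) * w ^ n‖ ≤ ‖F‖ * ‖w‖ ^ n := fun m n => by
      rw [norm_mul, norm_pow]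
      gcongr
      exact hF _
    refine eq_zero_of_forall_tsum_eq_zero (C := ∑' n, ‖F‖ * ‖w‖ ^ n)
      (fun m => tsum_of_norm_bounded hg.hasSum (hb m)) fun z hz => ?_
    have h2 := h (z, w) ⟨hz, hw⟩
    have h3 := F.summable_eval (z := (z, w)) ⟨hz, hw⟩
    rw [Hardy.eval, h3.tsum_prod] at h2
    rw [← h2]
    refine tsum_congr fun m => ?_
    rw [← tsum_mul_right]
    exact tsum_congr fun n => by ring
  ext k
  exact eq_zero_of_forall_tsum_eq_zero (a := fun n => F (k.1, n)) (fun n => hF _)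
    (fun w hw => h1 w hw k.1) k.2

theorem Hardy.eval_sub (F G : Hardy) {z : ℂ × ℂ} (hz : z ∈ bidisk) :
    (F - G).eval z = F.eval z - G.eval z := by
  rw [sub_eq_add_neg, ← neg_one_smul ℂ G, Hardy.eval_add _ _ hz, Hardy.eval_smul]
  ring

theorem Hardy.ext_eval {F G : Hardy} (h : ∀ z ∈ bidisk, F.eval z = G.eval z) : F = G :=
  sub_eq_zero.1 <| Hardy.eq_zero_of_eval _ fun z hz => by
    rw [Hardy.eval_sub _ _ hz, h z hz, sub_self]

/-! ### Multiplication by the second coordinate -/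

/-- The Taylor coefficients of `z₂ F`, in terms of those of `F`. -/
def shiftCoeffSnd (F : ℕ × ℕ → ℂ) (k : ℕ × ℕ) : ℂ := if k.2 = 0 then 0 else F (k.1, k.2 - 1)

theorem injective_succSnd : Function.Injective fun k : ℕ × ℕ => (k.1, k.2 + 1) := by
  rintro ⟨a, b⟩ ⟨c, d⟩ h
  simpa using h

theorem shiftCoeffSnd_succ (F : ℕ × ℕ → ℂ) (k : ℕ × ℕ) :
    shiftCoeffSnd F (k.1, k.2 + 1) = F k := by
  simp [shiftCoeffSnd]

theorem shiftCoeffSnd_of_notMem (F : ℕ × ℕ → ℂ) (k : ℕ × ℕ)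
    (hk : k ∉ Set.range fun k : ℕ × ℕ => (k.1, k.2 + 1)) : shiftCoeffSnd F k = 0 := by
  rcases k with ⟨m, _ | n⟩
  · simp [shiftCoeffSnd]
  · exact absurd ⟨(m, n), rfl⟩ hk

theorem hasSum_shiftCoeffSnd {F : Hardy} :
    HasSum (fun k => ‖shiftCoeffSnd F k‖ ^ (2 : ENNReal).toReal)
      (‖F‖ ^ (2 : ENNReal).toReal) := by
  rw [← injective_succSnd.hasSum_iff]
  · simpa only [Function.comp_def, shiftCoeffSnd_succ] using lp.hasSum_norm (by norm_num) F
  · intro k hk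
    simp [shiftCoeffSnd_of_notMem _ k hk]

/-- The operator `M_{z₂}` of multiplication by `z₂` on `H²(𝔻²)`. -/
def mulZ₂ : Hardy →L[ℂ] Hardy :=
  LinearIsometry.toContinuousLinearMap
    { toFun := fun F => ⟨shiftCoeffSnd F, memℓp_gen hasSum_shiftCoeffSnd.summable⟩
      map_add' := fun F G => by
        ext k
        simp only [lp.coeFn_add, Pi.add_apply, shiftCoeffSnd]
        split_ifs <;> simp
      map_smul' := fun c F => by
        ext k
        simp only [lp.coeFn_smul, Pi.smul_apply, shiftCoeffSnd, RingHom.id_apply, smul_eq_mul]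
        split_ifs <;> simp
      norm_map' := fun F => by
        have h1 := lp.hasSum_norm (p := 2) (by norm_num)
          (⟨shiftCoeffSnd F, memℓp_gen hasSum_shiftCoeffSnd.summable⟩ : Hardy)
        have h2 := h1.unique (hasSum_shiftCoeffSnd (F := F))
        exact (Real.rpow_left_inj (norm_nonneg _) (norm_nonneg _) (by norm_num)).1 h2 }

theorem mulZ₁_apply (F : Hardy) (k : ℕ × ℕ) : mulZ₁ F k = shiftCoeff F k := rfl

theorem mulZ₂_apply (F : Hardy) (k : ℕ × ℕ) : mulZ₂ F k = shiftCoeffSnd F k := rfl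

/-- `mulZ₂` is multiplication of functions on the bidisk by the second coordinate. -/
theorem eval_mulZ₂ (F : Hardy) (z : ℂ × ℂ) : (mulZ₂ F).eval z = z.2 * F.eval z := by
  unfold Hardy.eval
  rw [← tsum_mul_left, ← injective_succSnd.tsum_eq]
  · refine tsum_congr fun k => ?_
    rw [mulZ₂_apply, shiftCoeffSnd_succ]
    ring
  · intro k hk
    by_contra hk'
    exact hk (by simp only [mulZ₂_apply, shiftCoeffSnd_of_notMem _ k hk', zero_mul])

theorem mulZ₁_single (k : ℕ × ℕ) (a : ℂ) :
    mulZ₁ (lp.single 2 k a) = lp.single 2 (k.1 + 1, k.2) a := by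
  ext ⟨m, n⟩
  rcases k with ⟨i, j⟩
  rcases m with _ | m <;>
    simp [mulZ₁_apply, shiftCoeff, lp.single_apply, Pi.single_apply]

theorem mulZ₂_single (k : ℕ × ℕ) (a : ℂ) :
    mulZ₂ (lp.single 2 k a) = lp.single 2 (k.1, k.2 + 1) a := by
  ext ⟨m, n⟩
  rcases k with ⟨i, j⟩
  rcases n with _ | n <;>
    simp [mulZ₂_apply, shiftCoeffSnd, lp.single_apply, Pi.single_apply]

theorem adjoint_mulZ₁_apply (F : Hardy) (k : ℕ × ℕ) :
    adjoint mulZ₁ F k = F (k.1 + 1, k.2) := by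
  have h1 := adjoint_inner_right mulZ₁ (lp.single 2 k (1 : ℂ)) F
  rw [mulZ₁_single, lp.inner_single_left, lp.inner_single_left] at h1
  simpa using h1

theorem adjoint_mulZ₂_apply (F : Hardy) (k : ℕ × ℕ) :
    adjoint mulZ₂ F k = F (k.1, k.2 + 1) := by
  have h1 := adjoint_inner_right mulZ₂ (lp.single 2 k (1 : ℂ)) F
  rw [mulZ₂_single, lp.inner_single_left, lp.inner_single_left] at h1
  simpa using h1

theorem isShiftPair_mulZ : IsShiftPair mulZ₁ mulZ₂ where
  fst := by
    ext F k
    exact (adjoint_mulZ₁_apply (mulZ₁ F) k).trans (shiftCoeff_succ F k)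
  snd := by
    ext F k
    exact (adjoint_mulZ₂_apply (mulZ₂ F) k).trans (shiftCoeffSnd_succ F k)
  comm := by
    ext F k
    change mulZ₁ (mulZ₂ F) k = mulZ₂ (mulZ₁ F) k
    simp only [mulZ₁_apply, mulZ₂_apply, shiftCoeff, shiftCoeffSnd]
    split_ifs <;> rfl
  adjoint_comm := by
    ext F k
    change adjoint mulZ₁ (mulZ₂ F) k = mulZ₂ (adjoint mulZ₁ F) k
    simp only [adjoint_mulZ₁_apply, mulZ₂_apply, shiftCoeffSnd]
  eq_zero_of_adjoint := by
    intro F hF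
    -- The eigenvalue -1 makes coefficients constant in modulus along z₂, which square-summability
    -- allows only for zero.
    have h1 : ∀ m n, ‖F (m, n)‖ = ‖F (m, 0)‖ := fun m n => by
      induction n with
      | zero => rfl
      | succ n ih =>
        rw [← ih, ← adjoint_mulZ₂_apply F (m, n), hF, lp.coeFn_neg, Pi.neg_apply, norm_neg]
    have h2 : ∀ m, F (m, 0) = 0 := fun m => by
      have h3 := (lp.hasSum_norm (p := 2) (by norm_num) F).summable.comp_injective
        (Prod.mk_right_injective m)
      simp only [Function.comp_def, h1, summable_const_iff] at h3
      simpa using h3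
    ext ⟨m, n⟩
    have h4 := h1 m n
    rw [h2, norm_zero, norm_eq_zero] at h4
    exact h4

/-! ### Kernel functions of the second variable -/

/-- The Szegő kernel 1 / (1 - z₂ conj w), obtained by applying the inverse of 1 - conj w • `mulZ₂`
to the constant 1. -/
theorem exists_kernel {w : ℂ} (hw : ‖w‖ < 1) :
    ∃ κ : Hardy, adjoint mulZ₁ κ = 0 ∧ adjoint mulZ₂ κ = conj w • κ ∧ κ ≠ 0 ∧
      ∀ z ∈ bidisk, κ.eval z * (1 - z.2 * conj w) = 1 := by
  set e : Hardy := lp.single 2 (0, 0) 1 with he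
  have he₀ : ∀ k : ℕ × ℕ, k ≠ (0, 0) → e k = 0 := fun k hk => by
    rw [he, lp.single_apply_ne _ _ _ hk]
  have he₁ : adjoint mulZ₁ e = 0 := by
    ext k
    rw [adjoint_mulZ₁_apply, he₀ _ (by simp)]
    rfl
  have he₂ : adjoint mulZ₂ e = 0 := by
    ext k
    rw [adjoint_mulZ₂_apply, he₀ _ (by simp)]
    rfl
  have he₃ : ∀ z, e.eval z = 1 := fun z => by
    rw [Hardy.eval, tsum_eq_single (0, 0) fun k hk => by rw [he₀ k hk, zero_mul], he,
      lp.single_apply_self]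
    simp
  have h1 : IsUnit (1 - conj w • mulZ₂) := by
    refine isUnit_one_sub_of_norm_lt_one ?_
    have h2 : ‖mulZ₂‖ ≤ 1 := opNorm_le_bound _ zero_le_one fun y => by
      rw [isShiftPair_mulZ.norm_snd, one_mul]
    rw [norm_smul, RCLike.norm_conj]
    nlinarith [norm_nonneg w]
  obtain ⟨R, hR⟩ := h1.exists_right_inv
  set κ := R e with hκ
  have h3 : κ - conj w • mulZ₂ κ = e := congr($hR e)
  have h4 : κ = e + conj w • mulZ₂ κ := by rw [← h3, sub_add_cancel]
  have h5 : adjoint mulZ₂ κ = conj w • κ := by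
    conv_lhs => rw [h4]
    rw [map_add, map_smul, he₂, isShiftPair_mulZ.adjoint_snd_apply, zero_add]
  have h6 : ∀ z ∈ bidisk, κ.eval z * (1 - z.2 * conj w) = 1 := fun z hz => by
    have h7 := congr(Hardy.eval $h3 z)
    rw [he₃, Hardy.eval_sub _ _ hz, Hardy.eval_smul, eval_mulZ₂] at h7
    linear_combination h7
  refine ⟨κ, ?_, h5, ?_, h6⟩
  · have h7 : adjoint mulZ₁ κ - conj w • mulZ₂ (adjoint mulZ₁ κ) = 0 := by
      rw [← isShiftPair_mulZ.adjoint_comm_apply, ← map_smul, ← map_sub, h3, he₁]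
    obtain ⟨L, hL⟩ := h1.exists_left_inv
    have h8 : L ((1 - conj w • mulZ₂ : Hardy →L[ℂ] Hardy) (adjoint mulZ₁ κ)) =
      adjoint mulZ₁ κ := congr($hL (adjoint mulZ₁ κ))
    have h9 : (1 - conj w • mulZ₂ : Hardy →L[ℂ] Hardy) (adjoint mulZ₁ κ) = 0 := h7
    rw [← h8, h9, map_zero]
  · intro h7
    have h8 := h6 (0, 0) (by simp [bidisk])
    rw [h7, Hardy.eval_zero, zero_mul] at h8
    exact zero_ne_one h8

/-! ### The function-theoretic description of the operators -/

section Eval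

variable {c : ℝ}

theorem eval_pOp (F : Hardy) {z : ℂ × ℂ} (hz : z ∈ bidisk) :
    (pOp c mulZ₁ mulZ₂ F).eval z = poly ((1 + c : ℝ) : ℂ) (-1) c 0 z * F.eval z := by
  rw [pOp_apply, den_apply, Hardy.eval_sub _ _ hz, Hardy.eval_add _ _ hz, Hardy.eval_smul,
    Hardy.eval_smul, eval_mulZ₁, eval_mulZ₂, poly]
  ring

theorem eval_pReflOp (F : Hardy) {z : ℂ × ℂ} (hz : z ∈ bidisk) :
    (pReflOp c mulZ₁ mulZ₂ F).eval z = polyRefl ((1 + c : ℝ) : ℂ) (-1) c 0 z * F.eval z := by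
  rw [pReflOp_apply, denRefl_apply, Hardy.eval_sub _ _ hz, eval_mulZ₁, Hardy.eval_add _ _ hz,
    Hardy.eval_smul, Hardy.eval_smul, eval_mulZ₂, polyRefl]
  simp only [Complex.conj_ofReal, map_neg, map_one, map_zero]
  ring

theorem kerFactor_eq (hc : 0 < c) (z : ℂ × ℂ) :
    kerFactor ((1 + c : ℝ) : ℂ) (-1) c 0 (-1) z =
      (√((1 + c) * c) : ℂ) * (z.2 + 1) / poly ((1 + c : ℝ) : ℂ) (-1) c 0 z := by
  rw [kerFactor, Complex.conj_ofReal, zero_mul, sub_zero, ← Complex.ofReal_mul,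
    Complex.norm_real, Real.norm_of_nonneg (by positivity), sub_neg_eq_add]

theorem one_sub_mul_conj_ne_zero {z w : ℂ} (hz : ‖z‖ < 1) (hw : ‖w‖ < 1) :
    1 - z * conj w ≠ 0 := by
  intro h
  have h1 := congr(‖$(sub_eq_zero.1 h)‖)
  rw [norm_one, norm_mul, RCLike.norm_conj] at h1
  nlinarith [norm_nonneg z, norm_nonneg w]

/-- The algebraic span suffices, because the inequality to be proved on its closure is a closed
condition. -/
theorem isKernelPair_of_mem_span (hc : 0 < c)
    (hp : ∀ z ∈ bidisk, poly ((1 + c : ℝ) : ℂ) (-1) c 0 z ≠ 0) {F : Hardy}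
    (hF : F ∈ Submodule.span ℂ {F : Hardy | ∃ w ∈ bidisk, ∀ z ∈ bidisk, F.eval z =
      kerFactor ((1 + c : ℝ) : ℂ) (-1) c 0 (-1) z *
        conj (kerFactor ((1 + c : ℝ) : ℂ) (-1) c 0 (-1) w) / (1 - z.2 * conj w.2)}) :
    ∃ g, IsKernelPair c mulZ₁ mulZ₂ g F := by
  induction hF using Submodule.span_induction with
  | zero => exact ⟨0, .zero⟩
  | add x y _ _ hx hy =>
    obtain ⟨g, hg⟩ := hx
    obtain ⟨g', hg'⟩ := hy
    exact ⟨g + g', hg.add hg'⟩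
  | smul r x _ hx =>
    obtain ⟨g, hg⟩ := hx
    exact ⟨r • g, hg.smul r⟩
  | mem F hF =>
    obtain ⟨w, hw, hF⟩ := hF
    obtain ⟨κ, h1, -, -, h2⟩ := exists_kernel hw.2
    refine ⟨conj (kerFactor ((1 + c : ℝ) : ℂ) (-1) c 0 (-1) w) • κ, by rw [map_smul, h1, smul_zero],
      Hardy.ext_eval fun z hz => ?_⟩
    have h3 := one_sub_mul_conj_ne_zero hz.2 hw.2
    have h4 := hp z hz
    rw [eval_pOp _ hz, hF z hz, kerFactor_eq hc z, Hardy.eval_smul, Hardy.eval_add _ _ hz,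
      eval_mulZ₂, Hardy.eval_smul, eq_div_of_mul_eq h3 (h2 z hz)]
    field_simp
    ring

/-- F is a nonzero multiple of the reproducing kernel at (0, w), because f(0, w) ≠ 0. -/
theorem IsKernelPair.mem_S₂theta (hc : 0 < c)
    (hp : ∀ z ∈ bidisk, poly ((1 + c : ℝ) : ℂ) (-1) c 0 z ≠ 0) {w : ℂ} (hw : ‖w‖ < 1)
    {κ F : Hardy} (hκ : ∀ z ∈ bidisk, κ.eval z * (1 - z.2 * conj w) = 1)
    (hF : IsKernelPair c mulZ₁ mulZ₂ κ F) :
    F ∈ S₂theta ((1 + c : ℝ) : ℂ) (-1) c 0 (-1) := by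
  have hw' : ((0 : ℂ), w) ∈ bidisk := ⟨by simp, hw⟩
  set t := conj (kerFactor ((1 + c : ℝ) : ℂ) (-1) c 0 (-1) (0, w)) with ht
  have ht₀ : t ≠ 0 := by
    rw [ht, ne_eq, map_eq_zero, kerFactor_eq hc, div_eq_zero_iff, not_or]
    refine ⟨mul_ne_zero ?_ fun h => ?_, hp _ hw'⟩
    · exact_mod_cast (Real.sqrt_pos.2 (by positivity)).ne'
    · have h1 := congr(‖$(eq_neg_of_add_eq_zero_left h)‖)
      rw [norm_neg, norm_one] at h1
      exact hw.ne h1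
  refine Submodule.le_topologicalClosure _ ?_
  have h1 : F = t⁻¹ • t • F := (inv_smul_smul₀ ht₀ F).symm
  rw [h1]
  refine Submodule.smul_mem _ _ (Submodule.subset_span ⟨(0, w), hw', fun z hz => ?_⟩)
  have hF' := hF.pOp_eq
  have h2 := congr(Hardy.eval $hF' z)
  have h3 := one_sub_mul_conj_ne_zero hz.2 hw
  have h4 := hp z hz
  rw [eval_pOp _ hz, Hardy.eval_smul, Hardy.eval_add _ _ hz, eval_mulZ₂,
    eq_div_of_mul_eq h3 (hκ z hz), mul_comm] at h2
  beta_reduce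
  rw [Hardy.eval_smul, eq_div_of_mul_eq h4 h2, kerFactor_eq hc z, ← ht]
  field_simp
  ring

theorem mem_mulSpace_theta (hc : 0 < c)
    (hp : ∀ z ∈ bidisk, poly ((1 + c : ℝ) : ℂ) (-1) c 0 z ≠ 0) {S : Submodule ℂ Hardy}
    {F : Hardy} : F ∈ mulSpace (theta ((1 + c : ℝ) : ℂ) (-1) c 0) S ↔
      ∃ G ∈ S, F = thetaOp c mulZ₁ mulZ₂ G := by
  refine exists_congr fun G => and_congr_right fun _ => ⟨fun h => ?_, ?_⟩
  · refine isShiftPair_mulZ.eq_thetaOp_of_pOp_eq hc (Hardy.ext_eval fun z hz => ?_)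
    rw [eval_pOp _ hz, eval_pReflOp _ hz, h z hz, theta, ← mul_assoc,
      mul_div_cancel₀ _ (hp z hz)]
  · rintro rfl z hz
    have h1 := congr(Hardy.eval $(isShiftPair_mulZ.pOp_thetaOp hc G) z)
    rw [eval_pOp _ hz, eval_pReflOp _ hz, mul_comm] at h1
    rw [eq_div_of_mul_eq (hp z hz) h1, theta, div_mul_eq_mul_div]

end Eval

/-! ### The parameters -/

/-- The triangle inequality at τ gives a ≤ 1 + c. If a < 1 + c, some real point (a - sc, -s) is a
zero inside the bidisk. Then |a + cτ₂| = 1 determines τ₂. -/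
theorem eq_one_add_and_eq_neg_one {a c : ℝ} {τ : ℂ × ℂ} (ha : 0 < a) (hc : 0 < c)
    (hp : ∀ z ∈ bidisk, poly a (-1) c 0 z ≠ 0) (hτ : ‖τ.1‖ = 1 ∧ ‖τ.2‖ = 1)
    (hz : poly a (-1) c 0 τ = 0) : a = 1 + c ∧ τ.2 = -1 := by
  have h1 : (a : ℂ) + c * τ.2 = τ.1 := by
    rw [poly] at hz
    linear_combination hz
  have h2 : a ≤ 1 + c := by
    have h3 : (a : ℂ) = τ.1 - c * τ.2 := by rw [← h1]; ring
    have h4 := norm_sub_le τ.1 (c * τ.2)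
    rwa [← h3, norm_mul, Complex.norm_real, Complex.norm_real, hτ.1, hτ.2, mul_one,
      Real.norm_of_nonneg ha.le, Real.norm_of_nonneg hc.le] at h4
  have h3 : 1 + c ≤ a := by
    by_contra! h4
    obtain ⟨s, hs, hs'⟩ : ∃ s, max 0 ((a - 1) / c) < s ∧ s < min 1 ((a + 1) / c) := by
      refine exists_between (max_lt (lt_min one_pos (by positivity)) (lt_min ?_ ?_))
      · rw [div_lt_one hc]; linarith
      · gcongr; linarith
    rw [max_lt_iff, div_lt_iff₀ hc] at hs
    rw [lt_min_iff, lt_div_iff₀ hc] at hs'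
    refine hp (((a - s * c : ℝ) : ℂ), ((-s : ℝ) : ℂ)) ⟨?_, ?_⟩ ?_
    · rw [Complex.norm_real, Real.norm_eq_abs, abs_lt]
      constructor <;> linarith
    · rw [Complex.norm_real, Real.norm_eq_abs, abs_lt]
      constructor <;> linarith
    · rw [poly]
      push_cast
      ring
  have h4 : a = 1 + c := le_antisymm h2 h3
  refine ⟨h4, ?_⟩
  have h5 : ‖(a : ℂ) + c * τ.2‖ ^ 2 = 1 := by rw [h1, hτ.1, one_pow]
  have h6 : ‖τ.2‖ ^ 2 = 1 := by rw [hτ.2, one_pow]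
  rw [← Complex.normSq_eq_norm_sq, Complex.normSq_apply] at h5 h6
  simp only [Complex.add_re, Complex.add_im, Complex.ofReal_re, Complex.ofReal_im,
    Complex.re_ofReal_mul, Complex.im_ofReal_mul, zero_add] at h5
  have h7 : τ.2.re = -1 := by
    have h8 : 2 * ((1 + c) * c) * (τ.2.re + 1) = 0 := by
      subst h4
      linear_combination h5 - c ^ 2 * h6
    have h9 : 2 * ((1 + c) * c) ≠ 0 := by positivity
    linarith [(mul_eq_zero.1 h8).resolve_left h9]
  have h8 : τ.2.im = 0 := by
    rw [h7] at h6
    nlinarith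
  exact Complex.ext (by simpa using h7) (by simpa using h8)

/-! ### The numerical range of the compressed shift -/

theorem mem_numericalRange_compression {S : Submodule ℂ Hardy} [S.HasOrthogonalProjection]
    {T : Hardy →L[ℂ] Hardy} {ζ : ℂ} :
    ζ ∈ numericalRange (compression S T) ↔ ∃ h ∈ S, ‖h‖ = 1 ∧ inner ℂ h (T h) = ζ := by
  have h1 : ∀ h : S, inner ℂ h (compression S T h) = inner ℂ (h : Hardy) (T h) := fun h =>
    S.inner_orthogonalProjectionOnto_eq_of_mem_left h (T h)
  constructor
  · rintro ⟨h, hn, rfl⟩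
    exact ⟨h, h.2, hn, (h1 h).symm⟩
  · rintro ⟨h, hS, hn, rfl⟩
    exact ⟨⟨h, hS⟩, hn, h1 ⟨h, hS⟩⟩

section Range

variable {c₁ c₂ : ℝ}

/-- The estimate passes through three closures: that of the sum and those of the two kernel spaces.
-/
theorem le_re_inner_of_mem_S₂prod (hc₁ : 0 < c₁) (hc₂ : 0 < c₂)
    (hp₁ : ∀ z ∈ bidisk, poly ((1 + c₁ : ℝ) : ℂ) (-1) c₁ 0 z ≠ 0)
    (hp₂ : ∀ z ∈ bidisk, poly ((1 + c₂ : ℝ) : ℂ) (-1) c₂ 0 z ≠ 0)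
    {δ : ℝ} (hδ : 0 ≤ δ) (hδ' : δ ≤ 1)
    (hc : 4 * ((1 + c₁) * c₁) * ((1 + c₂) * c₂) ≤ (1 - δ) ^ 2 * ((1 + 2 * c₁) * (1 + 2 * c₂)))
    {h : Hardy} (hh : h ∈ S₂prod ((1 + c₁ : ℝ) : ℂ) (-1) c₁ 0 (-1)
      ((1 + c₂ : ℝ) : ℂ) (-1) c₂ 0 (-1)) :
    δ / (2 * (1 + c₁) * (1 + c₂)) * ‖h‖ ^ 2 ≤ (inner ℂ h (mulZ₁ h)).re := by
  set Y : Set Hardy := {h | δ / (2 * (1 + c₁) * (1 + c₂)) * ‖h‖ ^ 2 ≤ (inner ℂ h (mulZ₁ h)).re}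
    with hY
  have hYc : IsClosed Y :=
    isClosed_le (by fun_prop) (Complex.continuous_re.comp (by fun_prop))
  refine closure_minimal (t := Y) (fun y hy => ?_) hYc hh
  obtain ⟨x₁, hx₁, y₂, hy₂, rfl⟩ := Submodule.mem_sup.1 hy
  obtain ⟨x₂, hx₂, rfl⟩ := (mem_mulSpace_theta hc₁ hp₁).1 hy₂
  refine closure_minimal (t := (fun x => x₁ + thetaOp c₁ mulZ₁ mulZ₂ x) ⁻¹' Y) (fun x₂ hx₂ => ?_)
    (hYc.preimage (by fun_prop)) hx₂
  refine closure_minimal (t := (fun x => x + thetaOp c₁ mulZ₁ mulZ₂ x₂) ⁻¹' Y) (fun x₁ hx₁ => ?_)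
    (hYc.preimage (by fun_prop)) hx₁
  obtain ⟨g₁, hg₁⟩ := isKernelPair_of_mem_span hc₁ hp₁ hx₁
  obtain ⟨g₂, hg₂⟩ := isKernelPair_of_mem_span hc₂ hp₂ hx₂
  exact hg₁.le_re_inner_add_thetaOp isShiftPair_mulZ hc₁ hc₂ hδ hδ' hc hg₂

/-- The numerical range of the compressed shift contains those of the compressions to the
two-dimensional spaces spanned by `f₁ κ` and `θ₁ f₂ κ`, for kernel functions `κ`. -/
theorem mem_numericalRange_compressedShift (hc₁ : 0 < c₁) (hc₂ : 0 < c₂)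
    (hp₁ : ∀ z ∈ bidisk, poly ((1 + c₁ : ℝ) : ℂ) (-1) c₁ 0 z ≠ 0)
    (hp₂ : ∀ z ∈ bidisk, poly ((1 + c₂ : ℝ) : ℂ) (-1) c₂ 0 z ≠ 0)
    {w : ℝ} (hw : 0 ≤ w) (hw' : w < 1) {r s : ℂ} (hrs : ‖r‖ ^ 2 + ‖s‖ ^ 2 = 1) :
    ((1 / (1 + c₁ + c₁ * w) : ℝ) : ℂ) * (‖r‖ : ℂ) ^ 2 +
      ((1 / (1 + c₂ + c₂ * w) : ℝ) : ℂ) * (‖s‖ : ℂ) ^ 2 +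
      ((√((1 + c₁) * c₁) * √((1 + c₂) * c₂) * (1 + w) ^ 2 * (1 / (1 + c₁ + c₁ * w)) *
        (1 / (1 + c₂ + c₂ * w)) : ℝ) : ℂ) * (r * conj s) ∈
      numericalRange (compressedShift ((1 + c₁ : ℝ) : ℂ) (-1) c₁ 0 (-1)
        ((1 + c₂ : ℝ) : ℂ) (-1) c₂ 0 (-1)) := by
  have hw₀ : ‖(w : ℂ)‖ < 1 := by rwa [Complex.norm_real, Real.norm_of_nonneg hw]
  obtain ⟨κ, h1, h2, h3, h4⟩ := exists_kernel hw₀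
  rw [Complex.conj_ofReal] at h2
  obtain ⟨x₁, hx₁, -⟩ := isShiftPair_mulZ.exists_isKernelPair hc₁ h1
  obtain ⟨x₂, hx₂, -⟩ := isShiftPair_mulZ.exists_isKernelPair hc₂ h1
  have h5 : ‖κ‖ ≠ 0 := norm_ne_zero_iff.2 h3
  set t : ℂ := ((‖κ‖⁻¹ : ℝ) : ℂ)
  have h6 : ‖t • κ‖ = 1 := by
    rw [norm_smul, Complex.norm_real, norm_inv, norm_norm, inv_mul_cancel₀ h5]
  have h7 : adjoint mulZ₂ (t • κ) = (w : ℂ) • t • κ := by rw [map_smul, h2, smul_comm]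
  have hS₁ := hx₁.mem_S₂theta hc₁ hp₁ hw₀ h4
  have hS₂ := hx₂.mem_S₂theta hc₂ hp₂ hw₀ h4
  refine mem_numericalRange_compression.2 ⟨r • t • x₁ + thetaOp c₁ mulZ₁ mulZ₂ (s • t • x₂),
    ?_, ?_, (hx₁.smul t).inner_add_thetaOp_of_eigen isShiftPair_mulZ hc₁ hc₂ hw h7 h6
      (hx₂.smul t) r s⟩
  · refine Submodule.le_topologicalClosure _ (Submodule.add_mem_sup
      (Submodule.smul_mem _ _ (Submodule.smul_mem _ _ hS₁)) ?_)
    exact (mem_mulSpace_theta hc₁ hp₁).2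
      ⟨_, Submodule.smul_mem _ _ (Submodule.smul_mem _ _ hS₂), rfl⟩
  · rw [← sq_eq_sq₀ (norm_nonneg _) zero_le_one, one_pow,
      ((hx₁.smul t).smul r).norm_add_thetaOp_sq isShiftPair_mulZ hc₁, norm_smul r, norm_smul s,
      (hx₁.smul t).norm_eq isShiftPair_mulZ hc₁, (hx₂.smul t).norm_eq isShiftPair_mulZ hc₂, h6,
      mul_one, mul_one, hrs]

end Range

/-! ### Numerical ranges of two-by-two matrices -/

/-- If the numerical range of a triangular matrix has the origin strictly to the right of its
leftmost point, then it is a neighbourhood of the origin. -/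
theorem zero_mem_interior_of_quadratic {R : Set ℂ} {v₁ v₂ β : ℝ} (hv₁ : 0 < v₁) (hv₂ : 0 < v₂)
    (hβ : 0 < β) (h : 4 * (v₁ * v₂) < β ^ 2)
    (hR : ∀ r s : ℂ, ‖r‖ ^ 2 + ‖s‖ ^ 2 = 1 →
      (v₁ : ℂ) * (‖r‖ : ℂ) ^ 2 + v₂ * (‖s‖ : ℂ) ^ 2 + β * (r * conj s) ∈ R) :
    0 ∈ interior R := by
  -- With p = ‖r‖² fixed, the values fill the circle of centre C p and radius ρ p. At p = q the
  -- origin lies strictly inside it.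
  set C : ℝ → ℝ := fun p => v₁ * p + v₂ * (1 - p) with hC
  set ρ : ℝ → ℝ := fun p => β * (√p * √(1 - p)) with hρ
  set q := v₂ / (v₁ + v₂) with hq
  have hq₀ : 0 ≤ q := by positivity
  have hq₁ : q ≤ 1 := by rw [hq, div_le_one (by positivity)]; linarith
  have h1 : 1 - q = v₁ / (v₁ + v₂) := by rw [hq]; field_simp; ring
  have h2 : C q < ρ q := by
    have h3 : C q = 2 * (v₁ * v₂) / (v₁ + v₂) := by
      simp only [hC, h1]
      rw [hq]; ring
    have h4 : √q * √(1 - q) = √(v₁ * v₂) / (v₁ + v₂) := by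
      rw [← Real.sqrt_mul hq₀, h1, hq, div_mul_div_comm, Real.sqrt_div (by positivity),
        Real.sqrt_mul_self (by positivity), mul_comm v₂]
    have h5 : 2 * √(v₁ * v₂) < β := by
      refine lt_of_pow_lt_pow_left₀ 2 hβ.le ?_
      rw [mul_pow, Real.sq_sqrt (by positivity)]
      linarith
    have h6 : 0 < √(v₁ * v₂) := Real.sqrt_pos.2 (by positivity)
    simp only [hρ, h3, h4]
    rw [← mul_div_assoc]
    refine div_lt_div_of_pos_right ?_ (by positivity)
    have h7 := Real.mul_self_sqrt (show 0 ≤ v₁ * v₂ by positivity)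
    nlinarith [mul_lt_mul_of_pos_right h5 h6]
  rw [mem_interior_iff_mem_nhds, Metric.mem_nhds_iff]
  refine ⟨ρ q - C q, sub_pos.2 h2, fun ζ hζ => ?_⟩
  rw [mem_ball_zero_iff] at hζ
  have h3 : ContinuousOn (fun p : ℝ => ‖ζ - C p‖ - ρ p) (Set.Icc q 1) := by
    simp only [hC, hρ]
    fun_prop
  have h4 : ‖ζ - C q‖ - ρ q ≤ 0 := by
    have h5 := norm_sub_le ζ (C q)
    have h6 : 0 ≤ C q := by
      have : 0 ≤ 1 - q := by linarith
      positivity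
    rw [Complex.norm_real, Real.norm_of_nonneg h6] at h5
    linarith
  have h5 : 0 ≤ ‖ζ - C 1‖ - ρ 1 := by simp [hρ]
  -- A point ζ near 0 is inside the circle at p = q and not inside the degenerate circle at p = 1,
  -- so some intermediate circle passes through it.
  obtain ⟨p, hp, hp'⟩ := intermediate_value_Icc hq₁ h3 ⟨h4, h5⟩
  have hp₀ : 0 ≤ p := hq₀.trans hp.1
  have hp₁ : 0 ≤ 1 - p := sub_nonneg.2 hp.2
  obtain ⟨u, hu, hu'⟩ : ∃ u : ℂ, ‖u‖ = 1 ∧ ζ - C p = ρ p * u := by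
    have h4 : ‖ζ - C p‖ = ρ p := sub_eq_zero.1 hp'
    by_cases h5 : ρ p = 0
    · refine ⟨1, norm_one, ?_⟩
      rw [h5, norm_eq_zero] at h4
      rw [h4, h5, Complex.ofReal_zero, zero_mul]
    · have h6 : (ρ p : ℂ) ≠ 0 := Complex.ofReal_ne_zero.2 h5
      refine ⟨(ζ - C p) / ρ p, ?_, (mul_div_cancel₀ _ h6).symm⟩
      rw [norm_div, h4, Complex.norm_real, Real.norm_of_nonneg (h4 ▸ norm_nonneg _), div_self h5]
  have hr : ‖((√p : ℝ) : ℂ)‖ = √p := by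
    rw [Complex.norm_real, Real.norm_of_nonneg (Real.sqrt_nonneg _)]
  have hs : ‖((√(1 - p) : ℝ) : ℂ) * conj u‖ = √(1 - p) := by
    rw [norm_mul, RCLike.norm_conj, hu, Complex.norm_real,
      Real.norm_of_nonneg (Real.sqrt_nonneg _), mul_one]
  have h4 := hR (√p : ℝ) ((√(1 - p) : ℝ) * conj u) (by
    rw [hr, hs, Real.sq_sqrt hp₀, Real.sq_sqrt hp₁, add_sub_cancel])
  rw [hr, hs, ← Complex.ofReal_pow, ← Complex.ofReal_pow, Real.sq_sqrt hp₀, Real.sq_sqrt hp₁] at h4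
  convert h4 using 1
  rw [← sub_add_cancel ζ (C p : ℂ), hu', map_mul, Complex.conj_conj, Complex.conj_ofReal]
  simp only [hC, hρ]
  push_cast
  ring

/-- The leftmost point of the numerical range of a triangular matrix with positive diagonal. -/
theorem quadratic_leftmost {R : Set ℂ} {v₁ v₂ β : ℝ} (hv₁ : 0 < v₁) (hv₂ : 0 < v₂)
    (hR : ∀ r s : ℂ, ‖r‖ ^ 2 + ‖s‖ ^ 2 = 1 →
      (v₁ : ℂ) * (‖r‖ : ℂ) ^ 2 + v₂ * (‖s‖ : ℂ) ^ 2 + β * (r * conj s) ∈ R) :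
    (((2 * (v₁ * v₂) - β * √(v₁ * v₂)) / (v₁ + v₂) : ℝ) : ℂ) ∈ R := by
  have hr : ‖((√(v₂ / (v₁ + v₂)) : ℝ) : ℂ)‖ = √(v₂ / (v₁ + v₂)) := by
    rw [Complex.norm_real, Real.norm_of_nonneg (Real.sqrt_nonneg _)]
  have hs : ‖((-√(v₁ / (v₁ + v₂)) : ℝ) : ℂ)‖ = √(v₁ / (v₁ + v₂)) := by
    rw [Complex.norm_real, norm_neg, Real.norm_of_nonneg (Real.sqrt_nonneg _)]
  have h1 : 0 ≤ v₁ / (v₁ + v₂) := by positivity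
  have h2 : 0 ≤ v₂ / (v₁ + v₂) := by positivity
  have h3 : √(v₂ / (v₁ + v₂)) * √(v₁ / (v₁ + v₂)) = √(v₁ * v₂) / (v₁ + v₂) := by
    rw [← Real.sqrt_mul h2, div_mul_div_comm, Real.sqrt_div (by positivity),
      Real.sqrt_mul_self (by positivity), mul_comm v₂]
  -- This direction is the null vector of the form when β = 2√(v₁v₂), since the form is then (√v₁ r
  -- + √v₂ s)² for real r and s.
  have h4 := hR (√(v₂ / (v₁ + v₂)) : ℝ) (-√(v₁ / (v₁ + v₂)) : ℝ) (by
    rw [hr, hs, Real.sq_sqrt h1, Real.sq_sqrt h2]; field_simp; ring)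
  rw [hr, hs, Complex.conj_ofReal, ← Complex.ofReal_pow, ← Complex.ofReal_pow, Real.sq_sqrt h1,
    Real.sq_sqrt h2, ← Complex.ofReal_mul √_, mul_neg, h3] at h4
  convert h4 using 1
  norm_cast
  ring

/-! ### The position of the origin -/

section Origin

variable {c₁ c₂ : ℝ}

theorem zero_mem_interior_numericalRange (hc₁ : 0 < c₁) (hc₂ : 0 < c₂)
    (hp₁ : ∀ z ∈ bidisk, poly ((1 + c₁ : ℝ) : ℂ) (-1) c₁ 0 z ≠ 0)
    (hp₂ : ∀ z ∈ bidisk, poly ((1 + c₂ : ℝ) : ℂ) (-1) c₂ 0 z ≠ 0) (hc : 1 / 2 < c₁ * c₂) :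
    0 ∈ interior (numericalRange (compressedShift ((1 + c₁ : ℝ) : ℂ) (-1) c₁ 0 (-1)
        ((1 + c₂ : ℝ) : ℂ) (-1) c₂ 0 (-1))) := by
  have h1 : ContinuousAt (fun w : ℝ => (1 + c₁) * c₁ * ((1 + c₂) * c₂) * (1 + w) ^ 4 -
      4 * ((1 + c₁ + c₁ * w) * (1 + c₂ + c₂ * w))) 1 := by fun_prop
  -- Up to a positive factor this is β² - 4v₁v₂ at w = 1. It equals 4(2c₁c₂ - 1)(2c₁c₂ + 2c₁ + 2c₂ +
  -- 1) and stays positive for some w < 1.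
  have h2 : 0 < (1 + c₁) * c₁ * ((1 + c₂) * c₂) * (1 + (1 : ℝ)) ^ 4 -
      4 * ((1 + c₁ + c₁ * 1) * (1 + c₂ + c₂ * 1)) := by
    nlinarith [mul_pos (show 0 < c₁ * c₂ - 1 / 2 by linarith) (show 0 < c₁ + c₂ by linarith),
      mul_pos (show 0 < c₁ * c₂ - 1 / 2 by linarith) (show 0 < c₁ * c₂ + 1 / 2 by linarith)]
  have hn := nhdsWithin_le_nhds (a := (1 : ℝ)) (s := Set.Iio 1)
  obtain ⟨w, ⟨hw, hw₀'⟩, hw₁⟩ := (((h1.eventually (lt_mem_nhds h2)).filter_mono hn).and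
    ((show ∀ᶠ w : ℝ in 𝓝 1, 0 < w from lt_mem_nhds one_pos).filter_mono hn)).and
      (show ∀ᶠ w : ℝ in 𝓝[<] 1, w < 1 from self_mem_nhdsWithin) |>.exists
  refine zero_mem_interior_of_quadratic (by positivity) (by positivity) (by positivity) ?_
    fun r s hrs => mem_numericalRange_compressedShift hc₁ hc₂ hp₁ hp₂ hw₀'.le hw₁ hrs
  have h3 : 0 < 1 + c₁ + c₁ * w := by positivity
  have h4 : 0 < 1 + c₂ + c₂ * w := by positivity
  simp only [mul_pow, Real.sq_sqrt (show 0 ≤ (1 + c₁) * c₁ by positivity),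
    Real.sq_sqrt (show 0 ≤ (1 + c₂) * c₂ by positivity)]
  rw [← sub_pos]
  have h5 : (1 + c₁) * c₁ * ((1 + c₂) * c₂) * ((1 + w) ^ 2) ^ 2 * (1 / (1 + c₁ + c₁ * w)) ^ 2 *
      (1 / (1 + c₂ + c₂ * w)) ^ 2 - 4 * (1 / (1 + c₁ + c₁ * w) * (1 / (1 + c₂ + c₂ * w))) =
      ((1 + c₁) * c₁ * ((1 + c₂) * c₂) * (1 + w) ^ 4 -
      4 * ((1 + c₁ + c₁ * w) * (1 + c₂ + c₂ * w))) /
        ((1 + c₁ + c₁ * w) * (1 + c₂ + c₂ * w)) ^ 2 := by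
    field_simp
  rw [h5]
  exact div_pos hw (by positivity)

/-- At w = 1 the relation β = 2√(v₁v₂) holds exactly, so the points of `quadratic_leftmost` tend to
0 as w → 1 from below. -/
theorem zero_mem_closure_numericalRange (hc₁ : 0 < c₁) (hc₂ : 0 < c₂)
    (hp₁ : ∀ z ∈ bidisk, poly ((1 + c₁ : ℝ) : ℂ) (-1) c₁ 0 z ≠ 0)
    (hp₂ : ∀ z ∈ bidisk, poly ((1 + c₂ : ℝ) : ℂ) (-1) c₂ 0 z ≠ 0) (hc : c₁ * c₂ = 1 / 2) :
    0 ∈ closure (numericalRange (compressedShift ((1 + c₁ : ℝ) : ℂ) (-1) c₁ 0 (-1)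
        ((1 + c₂ : ℝ) : ℂ) (-1) c₂ 0 (-1))) := by
  set v₁ : ℝ → ℝ := fun w => 1 / (1 + c₁ + c₁ * w) with hv₁
  set v₂ : ℝ → ℝ := fun w => 1 / (1 + c₂ + c₂ * w) with hv₂
  set β : ℝ → ℝ := fun w => √((1 + c₁) * c₁) * √((1 + c₂) * c₂) * (1 + w) ^ 2 * v₁ w * v₂ w
    with hβ
  set F : ℝ → ℝ := fun w => (2 * (v₁ w * v₂ w) - β w * √(v₁ w * v₂ w)) / (v₁ w + v₂ w) with hF
  have hv₁c : ContinuousAt v₁ 1 := continuousAt_const.div (by fun_prop) (by positivity)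
  have hv₂c : ContinuousAt v₂ 1 := continuousAt_const.div (by fun_prop) (by positivity)
  have hFc : ContinuousAt F 1 := by
    refine ContinuousAt.div (by fun_prop) (by fun_prop) ?_
    simp only [hv₁, hv₂]
    positivity
  have hF₁ : F 1 = 0 := by
    have h1 : 0 < v₁ 1 * v₂ 1 := by simp only [hv₁, hv₂]; positivity
    have h2 : 4 * ((1 + c₁) * c₁ * ((1 + c₂) * c₂)) * (v₁ 1 * v₂ 1) = 1 := by
      simp only [hv₁, hv₂]
      field_simp
      linear_combination (4 * c₁ * c₂ + 4 * c₁ + 4 * c₂ + 2) * hc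
    have h3 : √((1 + c₁) * c₁) * √((1 + c₂) * c₂) * (2 * √(v₁ 1 * v₂ 1)) = 1 := by
      rw [← Real.sqrt_mul (by positivity), show (2 : ℝ) = √4 from (by
        rw [show (4 : ℝ) = 2 ^ 2 by norm_num, Real.sqrt_sq zero_le_two]),
        ← Real.sqrt_mul (by norm_num), ← Real.sqrt_mul (by positivity), Real.sqrt_eq_one]
      linear_combination h2
    have h4 : β 1 * √(v₁ 1 * v₂ 1) = 2 * (v₁ 1 * v₂ 1) := by
      simp only [hβ]
      linear_combination 2 * (v₁ 1 * v₂ 1) * h3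
    simp only [hF]
    rw [h4, sub_self, zero_div]
  have h1 : Tendsto (fun w => (F w : ℂ)) (𝓝[<] 1) (𝓝 0) := by
    have h2 : Tendsto (fun w => (F w : ℂ)) (𝓝 1) (𝓝 ((F 1 : ℝ) : ℂ)) :=
      (Complex.continuous_ofReal.tendsto _).comp hFc
    rw [hF₁, Complex.ofReal_zero] at h2
    exact h2.mono_left nhdsWithin_le_nhds
  refine mem_closure_of_tendsto h1 ?_
  filter_upwards [self_mem_nhdsWithin, nhdsWithin_le_nhds (lt_mem_nhds (zero_lt_one' ℝ))]
    with w hw hw₀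
  have hw₀' : 0 < w := hw₀
  refine quadratic_leftmost (by simp only [hv₁]; positivity) (by simp only [hv₂]; positivity)
    fun r s hrs => mem_numericalRange_compressedShift hc₁ hc₂ hp₁ hp₂ hw₀'.le hw hrs

theorem le_re_of_mem_numericalRange (hc₁ : 0 < c₁) (hc₂ : 0 < c₂)
    (hp₁ : ∀ z ∈ bidisk, poly ((1 + c₁ : ℝ) : ℂ) (-1) c₁ 0 z ≠ 0)
    (hp₂ : ∀ z ∈ bidisk, poly ((1 + c₂ : ℝ) : ℂ) (-1) c₂ 0 z ≠ 0)
    {δ : ℝ} (hδ : 0 ≤ δ) (hδ' : δ ≤ 1)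
    (hc : 4 * ((1 + c₁) * c₁) * ((1 + c₂) * c₂) ≤ (1 - δ) ^ 2 * ((1 + 2 * c₁) * (1 + 2 * c₂)))
    {ζ : ℂ} (hζ : ζ ∈ numericalRange (compressedShift ((1 + c₁ : ℝ) : ℂ) (-1) c₁ 0 (-1)
        ((1 + c₂ : ℝ) : ℂ) (-1) c₂ 0 (-1))) :
    δ / (2 * (1 + c₁) * (1 + c₂)) ≤ ζ.re := by
  obtain ⟨h, hS, hn, rfl⟩ := mem_numericalRange_compression.1 hζ
  have h1 := le_re_inner_of_mem_S₂prod hc₁ hc₂ hp₁ hp₂ hδ hδ' hc hS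
  rwa [hn, one_pow, mul_one] at h1

theorem zero_notMem_interior_numericalRange (hc₁ : 0 < c₁) (hc₂ : 0 < c₂)
    (hp₁ : ∀ z ∈ bidisk, poly ((1 + c₁ : ℝ) : ℂ) (-1) c₁ 0 z ≠ 0)
    (hp₂ : ∀ z ∈ bidisk, poly ((1 + c₂ : ℝ) : ℂ) (-1) c₂ 0 z ≠ 0) (hc : c₁ * c₂ ≤ 1 / 2) :
    0 ∉ interior (numericalRange (compressedShift ((1 + c₁ : ℝ) : ℂ) (-1) c₁ 0 (-1)
        ((1 + c₂ : ℝ) : ℂ) (-1) c₂ 0 (-1))) := by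
  intro h0
  obtain ⟨ε, hε, hb⟩ := Metric.mem_nhds_iff.1 (mem_interior_iff_mem_nhds.1 h0)
  have h1 : ((-(ε / 2) : ℝ) : ℂ) ∈ Metric.ball (0 : ℂ) ε := by
    rw [mem_ball_zero_iff, Complex.norm_real, norm_neg, Real.norm_of_nonneg (by positivity)]
    exact half_lt_self hε
  -- With δ = 0 the numerical range lies in the closed right half-plane, which excludes -ε / 2.
  have h2 := le_re_of_mem_numericalRange hc₁ hc₂ hp₁ hp₂ le_rfl zero_le_one (by
    have h3 : 0 < c₁ * c₂ := by positivity
    nlinarith [mul_nonneg (show 0 ≤ 1 / 2 - c₁ * c₂ by linarith) (show 0 ≤ c₁ + c₂ by linarith),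
      mul_nonneg (show 0 ≤ 1 / 2 - c₁ * c₂ by linarith)
        (show 0 ≤ c₁ * c₂ + 1 / 2 by linarith)]) (hb h1)
  rw [zero_div, Complex.ofReal_re] at h2
  linarith

theorem zero_notMem_closure_numericalRange (hc₁ : 0 < c₁) (hc₂ : 0 < c₂)
    (hp₁ : ∀ z ∈ bidisk, poly ((1 + c₁ : ℝ) : ℂ) (-1) c₁ 0 z ≠ 0)
    (hp₂ : ∀ z ∈ bidisk, poly ((1 + c₂ : ℝ) : ℂ) (-1) c₂ 0 z ≠ 0) (hc : c₁ * c₂ < 1 / 2) :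
    0 ∉ closure (numericalRange (compressedShift ((1 + c₁ : ℝ) : ℂ) (-1) c₁ 0 (-1)
        ((1 + c₂ : ℝ) : ℂ) (-1) c₂ 0 (-1))) := by
  set M := (1 + 2 * c₁) * (1 + 2 * c₂) with hM
  set N := 4 * ((1 + c₁) * c₁) * ((1 + c₂) * c₂) with hN
  have hM₀ : 0 < M := by positivity
  have hN₀ : 0 < N := by positivity
  have hNM : N < M := by
    have h3 : 0 < c₁ * c₂ := by positivity
    rw [hM, hN]
    nlinarith [mul_pos (show 0 < 1 / 2 - c₁ * c₂ by linarith) (show 0 < c₁ + c₂ by linarith),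
      mul_pos (show 0 < 1 / 2 - c₁ * c₂ by linarith) (show 0 < c₁ * c₂ + 1 / 2 by linarith)]
  -- Chosen so that (1 - 2δ)M = N; then (1 - δ)² ≥ 1 - 2δ gives the hypothesis of the lower bound.
  set δ := (M - N) / (2 * M) with hδ
  have hδ₀ : 0 < δ := div_pos (by linarith) (by positivity)
  have hδ₁ : δ ≤ 1 := by rw [hδ, div_le_one (by positivity)]; linarith
  have h1 : N ≤ (1 - δ) ^ 2 * M := by
    have h2 : 2 * δ * M = M - N := by rw [hδ]; field_simp
    nlinarith [mul_nonneg (sq_nonneg δ) hM₀.le]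
  intro h0
  have h2 : (0 : ℂ) ∈ {ζ : ℂ | δ / (2 * (1 + c₁) * (1 + c₂)) ≤ ζ.re} :=
    closure_minimal (fun ζ hζ => le_re_of_mem_numericalRange hc₁ hc₂ hp₁ hp₂ hδ₀.le hδ₁ h1 hζ)
      (isClosed_le continuous_const Complex.continuous_re) h0
  have h3 : 0 < δ / (2 * (1 + c₁) * (1 + c₂)) := by positivity
  exact absurd h2 (not_le.2 h3)

end Origin

end BidiskShift

end

theorem proposition5p3 (a₁ c₁ a₂ c₂ : ℝ) (τ₁ τ₂ : ℂ × ℂ)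
    (ha₁ : 0 < a₁) (hc₁ : 0 < c₁) (ha₂ : 0 < a₂) (hc₂ : 0 < c₂)
    (hp₁ : ∀ z ∈ BidiskShift.bidisk, BidiskShift.poly a₁ (-1) c₁ 0 z ≠ 0)
    (hp₂ : ∀ z ∈ BidiskShift.bidisk, BidiskShift.poly a₂ (-1) c₂ 0 z ≠ 0)
    (hτ₁ : ‖τ₁.1‖ = 1 ∧ ‖τ₁.2‖ = 1) (hz₁ : BidiskShift.poly a₁ (-1) c₁ 0 τ₁ = 0)
    (hτ₂ : ‖τ₂.1‖ = 1 ∧ ‖τ₂.2‖ = 1) (hz₂ : BidiskShift.poly a₂ (-1) c₂ 0 τ₂ = 0) :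
    ((0 : ℂ) ∈ interior (BidiskShift.numericalRange
        (BidiskShift.compressedShift a₁ (-1) c₁ 0 τ₁.2 a₂ (-1) c₂ 0 τ₂.2)) ↔ 1 / 2 < c₁ * c₂) ∧
    ((0 : ℂ) ∈ frontier (BidiskShift.numericalRange
        (BidiskShift.compressedShift a₁ (-1) c₁ 0 τ₁.2 a₂ (-1) c₂ 0 τ₂.2)) ↔ c₁ * c₂ = 1 / 2) := by
  obtain ⟨rfl, h₁⟩ := BidiskShift.eq_one_add_and_eq_neg_one ha₁ hc₁ hp₁ hτ₁ hz₁
  obtain ⟨rfl, h₂⟩ := BidiskShift.eq_one_add_and_eq_neg_one ha₂ hc₂ hp₂ hτ₂ hz₂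
  rw [h₁, h₂]
  -- The frontier is the closure minus the interior, so each case needs only the position of 0
  -- relative to these two sets.
  rcases lt_trichotomy (c₁ * c₂) (1 / 2) with h | h | h
  · have h0 := BidiskShift.zero_notMem_closure_numericalRange hc₁ hc₂ hp₁ hp₂ h
    exact ⟨iff_of_false (fun hi => h0 (subset_closure (interior_subset hi))) h.not_gt,
      iff_of_false (fun hf => h0 hf.1) h.ne⟩
  · have h0 := BidiskShift.zero_notMem_interior_numericalRange hc₁ hc₂ hp₁ hp₂ h.le
    exact ⟨iff_of_false h0 h.le.not_gt, iff_of_true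
      ⟨BidiskShift.zero_mem_closure_numericalRange hc₁ hc₂ hp₁ hp₂ h, h0⟩ h⟩
  · have h0 := BidiskShift.zero_mem_interior_numericalRange hc₁ hc₂ hp₁ hp₂ h
    exact ⟨iff_of_true h0 h, iff_of_false (fun hf => hf.2 h0) h.ne'⟩
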